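/- Let $G$ be a finite group and $p$ a prime. Suppose that $G$ is $p$-separable (it has a normal series each of whose factors is a $p$-group or has order prime to $p$), and let $H$ be a $p$-complement of $G$, i.e. a subgroup whose order is not divisible by $p$ and whose index is a power of $p$. Let $\Gamma_p(G)$ be the graph whose vertices are the non-central conjugacy classes of elements of $G$ of order not divisible by $p$, two distinct classes being adjacent if and only if their cardinalities are not coprime. If $\Gamma_p(G)$ is non-connected (that is, it has at least two connected components) and contains no triangle, then $H$ is a quasi-Frobenius group with abelian kernel and abelian complements, and $\mathbf{Z}(H)=H\cap\mathbf{Z}(G)$. Here a group $H$ is called quasi-Frobenius if $H/\mathbf{Z}(H)$ is a Frobenius group, and the kernel and the complements of $H$ are the inverse images in $H$ of the Frobenius kernel and the Frobenius complements of $H/\mathbf{Z}(H)$. -/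

import Mathlib

/-- A (finite) group `G` is `p`-separable if it has a finite series `1 = N 0 ≤ N 1 ≤ ⋯ ≤ N n = G`
of normal subgroups of `G` such that the order of every factor `N (i + 1) / N i` is either a
power of `p` or not divisible by `p`. -/
def IsPSeparable (p : ℕ) (G : Type*) [Group G] : Prop :=
  ∃ (n : ℕ) (N : ℕ → Subgroup G),
    N 0 = ⊥ ∧ N n = ⊤ ∧ (∀ i ≤ n, (N i).Normal) ∧
    ∀ i < n, N i ≤ N (i + 1) ∧
      ((∃ k : ℕ, (N i).relIndex (N (i + 1)) = p ^ k) ∨ ¬ p ∣ (N i).relIndex (N (i + 1)))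

/-- `H` is a `p`-complement of the (finite) group `G`, i.e. a Hall `p'`-subgroup:
its order is not divisible by `p` and its index is a power of `p`. -/
def IsPComplement (p : ℕ) {G : Type*} [Group G] (H : Subgroup G) : Prop :=
  ¬ p ∣ Nat.card H ∧ ∃ k : ℕ, H.index = p ^ k

/-- The vertices of `Γ_p(G)`: the non-central conjugacy classes of `p`-regular elements, i.e. of
elements whose order is not divisible by `p`. -/
def PRegularClass (p : ℕ) (G : Type*) [Group G] : Type _ :=
  {C : ConjClasses G // C ∈ ConjClasses.noncenter G ∧ ∀ g ∈ C.carrier, ¬ p ∣ orderOf g}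

/-- The common divisor graph `Γ_p(G)` on the non-central `p`-regular conjugacy classes: two
different classes are adjacent if and only if their cardinalities are not coprime. -/
def pRegularGraph (p : ℕ) (G : Type*) [Group G] : SimpleGraph (PRegularClass p G) where
  Adj C D := C ≠ D ∧ ¬ (Nat.card C.1.carrier).Coprime (Nat.card D.1.carrier)
  symm := ⟨fun _ _ h => ⟨h.1.symm, fun h' => h.2 h'.symm⟩⟩
  loopless := ⟨fun _ h => h.1 rfl⟩

/-- `G` is a Frobenius group with kernel `N` and complement `K`: it is the internal semidirect
product of the non-trivial normal subgroup `N` and the non-trivial subgroup `K`, and no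
non-trivial element of `K` commutes with a non-trivial element of `N`. -/
structure IsFrobeniusWith {G : Type*} [Group G] (N K : Subgroup G) : Prop where
  normal : N.Normal
  kernel_ne_bot : N ≠ ⊥
  complement_ne_bot : K ≠ ⊥
  isComplement : N.IsComplement' K
  fixedPointFree : ∀ k ∈ K, k ≠ 1 → ∀ n ∈ N, k * n = n * k → n = 1

/-- `G` is quasi-Frobenius if `G / Z(G)` is a Frobenius group. -/
def IsQuasiFrobenius (G : Type*) [Group G] : Prop :=
  ∃ N K : Subgroup (G ⧸ Subgroup.center G), IsFrobeniusWith N K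

/-- `M` is a kernel of the quasi-Frobenius group `G`: the inverse image in `G` of a Frobenius
kernel of `G / Z(G)`. -/
def IsQuasiFrobeniusKernel {G : Type*} [Group G] (M : Subgroup G) : Prop :=
  ∃ N K : Subgroup (G ⧸ Subgroup.center G), IsFrobeniusWith N K ∧
    M = N.comap (QuotientGroup.mk' (Subgroup.center G))

/-- `L` is a complement of the quasi-Frobenius group `G`: the inverse image in `G` of a Frobenius
complement of `G / Z(G)`. -/
def IsQuasiFrobeniusComplement {G : Type*} [Group G] (L : Subgroup G) : Prop :=
  ∃ N K : Subgroup (G ⧸ Subgroup.center G), IsFrobeniusWith N K ∧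
    L = K.comap (QuotientGroup.mk' (Subgroup.center G))

/-! Take a `p`-regular `b₀` with a class of maximal size and let `A` be the set of non-central
`p`-regular elements whose classes lie outside the component of `b₀`. If `x` and `a` have classes of
coprime sizes, then `G` is transitive on pairs of their conjugates (`exists_conj_of_coprime`). So if
the class of `x * a` is not larger than that of `x`, the class of `x` is stable under right
multiplication by all `b * a⁻¹` with `b` conjugate to `a`, and the order of any group of such
stabilizing elements divides `classSize x`.

For `x = b₀` this bounds the order of the normal subgroup generated by these quotients by a number
coprime to every `classSize a`. Two coprime index arguments then show that `A` is commutative, so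
`A` and the central `p`-regular elements generate an abelian normal `p'`-subgroup `M`, contained in
`H`. Applied to `p`-regular `x` outside `M`, the same argument gives all their classes a common
prime divisor. Without triangles there are at most two such classes.

This makes the index of `M` divisible by no primes besides `p` and a single `r`, where `r` divides
all class sizes in `A` (`exists_prime`). The hard point is that no such size is a power of `p`
(`exists_prime_ne_dvd_classSize`). It follows that elements of `H` outside `M` act fixed point
freely on `M` modulo the center. Finally `H / M` is a Sylow `r`-subgroup of `G / M` in which
commuting elements lie in a common cyclic subgroup and class sizes are prime to `r`, so it is
cyclic. Hence `H` modulo its center is Frobenius with abelian kernel and cyclic complement. -/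

/-- The size of the conjugacy class of `x`, as the index of its centralizer. -/
noncomputable def classSize {G : Type*} [Group G] (x : G) : ℕ := (Subgroup.centralizer {x}).index

/-! ### Class sizes, pairs of coprime classes, stabilizers of classes -/

section ClassSize

variable {G : Type*} [Group G]

theorem classSize_eq_ncard_carrier (x : G) :
    classSize x = (ConjClasses.mk x).carrier.ncard := by
  have h := MulAction.index_stabilizer (ConjAct G) x
  rw [ConjAct.orbit_eq_carrier_conjClasses, ConjAct.stabilizer_eq_centralizer] at h
  exact h

theorem classSize_eq_ncard_isConj (x : G) : classSize x = {y | IsConj x y}.ncard := by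
  rw [classSize_eq_ncard_carrier]
  rfl

theorem IsConj.classSize_eq {x y : G} (h : IsConj x y) : classSize x = classSize y := by
  rw [classSize_eq_ncard_carrier, classSize_eq_ncard_carrier,
    ConjClasses.mk_eq_mk_iff_isConj.2 h]

theorem isConj_conj (g x : G) : IsConj x (g * x * g⁻¹) := isConj_iff.2 ⟨g, rfl⟩

theorem IsConj.orderOf_eq' {x y : G} (h : IsConj x y) : orderOf x = orderOf y := by
  obtain ⟨g, rfl⟩ := isConj_iff.1 h
  exact (orderOf_injective (MulAut.conj g).toMonoidHom (MulAut.conj g).injective x).symm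

theorem classSize_dvd_of_forall_commute {x y : G} (h : ∀ g, Commute g x → Commute g y) :
    classSize y ∣ classSize x :=
  Subgroup.index_dvd_of_le fun g hg => by
    rw [Subgroup.mem_centralizer_singleton_iff] at hg ⊢
    exact h g hg

theorem classSize_pow_dvd (x : G) (n : ℕ) : classSize (x ^ n) ∣ classSize x :=
  classSize_dvd_of_forall_commute fun _ h => h.pow_right n

theorem classSize_eq_one_iff {x : G} : classSize x = 1 ↔ x ∈ Subgroup.center G := by
  rw [classSize, Subgroup.index_eq_one, Subgroup.mem_center_iff, Subgroup.eq_top_iff']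
  exact forall_congr' fun g => Subgroup.mem_centralizer_singleton_iff

/-- A product of two commuting elements of coprime orders has both factors as powers. -/
theorem Commute.exists_pow_mul_eq {x y : G} (h : Commute x y)
    (hxy : (orderOf x).Coprime (orderOf y)) : ∃ n : ℕ, (x * y) ^ n = x := by
  obtain ⟨n, hn1, hn0⟩ := Nat.chineseRemainder hxy 1 0
  refine ⟨n, ?_⟩
  rw [h.mul_pow, (orderOf_dvd_iff_pow_eq_one).1 ((Nat.modEq_zero_iff_dvd).1 hn0), mul_one]
  conv_rhs => rw [← pow_one x]
  exact (pow_eq_pow_iff_modEq).2 hn1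

theorem Commute.classSize_dvd_mul {x y : G} (h : Commute x y)
    (hxy : (orderOf x).Coprime (orderOf y)) :
    classSize x ∣ classSize (x * y) ∧ classSize y ∣ classSize (x * y) := by
  obtain ⟨n, hn⟩ := h.exists_pow_mul_eq hxy
  obtain ⟨m, hm⟩ := h.symm.exists_pow_mul_eq hxy.symm
  rw [← h.eq] at hm
  refine ⟨?_, ?_⟩
  · conv_lhs => rw [← hn]
    exact classSize_pow_dvd _ _
  · conv_lhs => rw [← hm]
    exact classSize_pow_dvd _ _

/-- The order of a subgroup stabilizing a class divides the size of the class. -/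
theorem card_dvd_classSize {x : G} {K : Subgroup G}
    (hK : ∀ k ∈ K, ∀ y, IsConj x y → IsConj x (y * k)) : Nat.card K ∣ classSize x := by
  -- The class is a union of left cosets of `K`.
  have h := QuotientGroup.card_preimage_mk K (QuotientGroup.mk '' {y | IsConj x y})
  have heq : (QuotientGroup.mk ⁻¹' (QuotientGroup.mk '' {y | IsConj x y} : Set (G ⧸ K))) =
      {y | IsConj x y} := by
    refine Set.Subset.antisymm ?_ (Set.subset_preimage_image _ _)
    rintro z ⟨y, hy, hyz⟩
    have := hK _ (QuotientGroup.eq.1 hyz) y hy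
    simpa using this
  rw [heq, Nat.card_coe_set_eq, ← classSize_eq_ncard_isConj] at h
  exact ⟨_, h⟩

theorem Sylow.exists_orderOf_eq_pow {s : ℕ} [hs : Fact s.Prime] (S : Sylow s G) {x : G}
    (hx : x ∈ S) : ∃ k, orderOf x = s ^ k := by
  obtain ⟨k, hk⟩ := IsPGroup.iff_orderOf.1 S.isPGroup' ⟨x, hx⟩
  exact ⟨k, by rw [← hk, Subgroup.orderOf_mk]⟩

variable [Finite G]

theorem classSize_pos (x : G) : 0 < classSize x :=
  Nat.pos_of_ne_zero Subgroup.FiniteIndex.index_ne_zero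

/-- The index of an intersection is at most the product of the indices and is divisible by each;
coprimality forces equality. -/
theorem index_inf_centralizer_of_coprime {x a : G} (h : (classSize x).Coprime (classSize a)) :
    (Subgroup.centralizer {x} ⊓ Subgroup.centralizer {a}).index = classSize x * classSize a := by
  refine le_antisymm Subgroup.index_inf_le ?_
  refine Nat.le_of_dvd (Nat.pos_of_ne_zero Subgroup.FiniteIndex.index_ne_zero) ?_
  exact h.mul_dvd_of_dvd_of_dvd (Subgroup.index_dvd_of_le inf_le_left)
    (Subgroup.index_dvd_of_le inf_le_right)

theorem classSize_mul_dvd_of_coprime {x a : G} (h : (classSize x).Coprime (classSize a)) :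
    classSize (x * a) ∣ classSize x * classSize a := by
  rw [← index_inf_centralizer_of_coprime h]
  refine Subgroup.index_dvd_of_le fun g hg => ?_
  rw [Subgroup.mem_inf, Subgroup.mem_centralizer_singleton_iff,
    Subgroup.mem_centralizer_singleton_iff] at hg
  rw [Subgroup.mem_centralizer_singleton_iff]
  exact (show Commute g x from hg.1).mul_right hg.2

/-- If two classes have coprime sizes, then all pairs of their elements are simultaneously
conjugate. -/
theorem exists_conj_of_coprime {x a y b : G} (h : (classSize x).Coprime (classSize a))
    (hy : IsConj x y) (hb : IsConj a b) : ∃ k : G, k * x * k⁻¹ = y ∧ k * a * k⁻¹ = b := by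
  -- By coprimality both sides have `classSize x * classSize a` elements, so injectivity suffices.
  let f : G ⧸ (Subgroup.centralizer {x} ⊓ Subgroup.centralizer {a}) →
      {y | IsConj x y} ×ˢ {b | IsConj a b} :=
    Quotient.lift (fun k => (⟨(k * x * k⁻¹, k * a * k⁻¹), isConj_conj k x, isConj_conj k a⟩ :
      {y | IsConj x y} ×ˢ {b | IsConj a b})) (by
      intro k l hkl
      replace hkl := QuotientGroup.leftRel_apply.1 hkl
      rw [Subgroup.mem_inf, Subgroup.mem_centralizer_singleton_iff,
        Subgroup.mem_centralizer_singleton_iff] at hkl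
      refine Subtype.ext (Prod.ext ?_ ?_)
      · have := congrArg (fun t => k * t * l⁻¹) hkl.1
        simpa [mul_assoc] using this.symm
      · have := congrArg (fun t => k * t * l⁻¹) hkl.2
        simpa [mul_assoc] using this.symm)
  have hf : Function.Injective f := by
    rintro ⟨k⟩ ⟨l⟩ hkl
    have h1 : k * x * k⁻¹ = l * x * l⁻¹ := congrArg (fun t => t.1.1) hkl
    have h2 : k * a * k⁻¹ = l * a * l⁻¹ := congrArg (fun t => t.1.2) hkl
    refine Quotient.sound (QuotientGroup.leftRel_apply.2 ?_)
    rw [Subgroup.mem_inf, Subgroup.mem_centralizer_singleton_iff,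
      Subgroup.mem_centralizer_singleton_iff]
    constructor
    · have := congrArg (fun t => k⁻¹ * t * l) h1
      simpa [mul_assoc] using this.symm
    · have := congrArg (fun t => k⁻¹ * t * l) h2
      simpa [mul_assoc] using this.symm
  have hcard : Nat.card (G ⧸ (Subgroup.centralizer {x} ⊓ Subgroup.centralizer {a})) =
      Nat.card ({y | IsConj x y} ×ˢ {b | IsConj a b} : Set (G × G)) := by
    rw [← Subgroup.index, index_inf_centralizer_of_coprime h, Nat.card_coe_set_eq,
      Set.ncard_prod, classSize_eq_ncard_isConj, classSize_eq_ncard_isConj]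
  have hbij := (Nat.bijective_iff_injective_and_card f).2 ⟨hf, hcard⟩
  obtain ⟨⟨k⟩, hk⟩ := hbij.2 ⟨(y, b), hy, hb⟩
  exact ⟨k, congrArg (fun t => t.1.1) hk, congrArg (fun t => t.1.2) hk⟩

/-- If the class of `x * a` is not larger than that of `x`, then the class of `x` is stable under
multiplication by the quotients of elements of the class of `a`. -/
theorem isConj_mul_conj_mul_inv {x a y b : G} (h : (classSize x).Coprime (classSize a))
    (hle : classSize (x * a) ≤ classSize x) (hy : IsConj x y) (hb : IsConj a b) :
    IsConj x (y * (b * a⁻¹)) := by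
  -- Each pair `(z, a)` with `z` conjugate to `x` is conjugate to `(x, a)`. The size bound turns the
  -- inclusion into an equality.
  have hsub : (fun z => z * a) '' {y | IsConj x y} ⊆ {z | IsConj (x * a) z} := by
    rintro _ ⟨z, hz, rfl⟩
    obtain ⟨k, rfl, hk⟩ := exists_conj_of_coprime h hz (IsConj.refl a)
    refine isConj_iff.2 ⟨k, ?_⟩
    conv_rhs => rw [← hk]
    group
  have heq := Set.eq_of_subset_of_ncard_le hsub (by
    rw [Set.ncard_image_of_injective _ (mul_left_injective a), ← classSize_eq_ncard_isConj,
      ← classSize_eq_ncard_isConj]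
    exact hle)
  obtain ⟨k, rfl, rfl⟩ := exists_conj_of_coprime h hy hb
  -- The product of the two given conjugates is conjugate to `x * a` as well, hence of the form `z *
  -- a` with `z` conjugate to `x`.
  have hmem : k * x * k⁻¹ * (k * a * k⁻¹) ∈ {z | IsConj (x * a) z} :=
    isConj_iff.2 ⟨k, by group⟩
  rw [← heq] at hmem
  obtain ⟨z, hz, hza⟩ := hmem
  rw [← mul_assoc, ← hza]
  simpa using hz

/-- The elements stabilizing a class by right multiplication form a subgroup. -/
def classStabilizer (x : G) : Subgroup G :=
  { (Submonoid.mk (Subsemigroup.mk {k : G | ∀ y, IsConj x y → IsConj x (y * k)}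
      (fun {k l} hk hl y hy => by
        rw [← mul_assoc]; exact hl _ (hk _ hy))) (fun y hy => by simpa using hy)) with
    inv_mem' := by
      intro k hk
      have hpow : ∀ n : ℕ, ∀ y, IsConj x y → IsConj x (y * k ^ n) := by
        intro n
        induction n with
        | zero => intro y hy; simpa using hy
        | succ n ih => intro y hy; rw [pow_succ, ← mul_assoc]; exact hk _ (ih y hy)
      have hinv : k⁻¹ = k ^ (orderOf k - 1) := by
        rw [inv_eq_iff_mul_eq_one, ← pow_succ', Nat.sub_add_cancel (orderOf_pos k),
          pow_orderOf_eq_one]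
      change ∀ y, IsConj x y → IsConj x (y * k⁻¹)
      rw [hinv]
      exact hpow _ }

theorem card_dvd_classSize_of_le {x : G} {K : Subgroup G} (hK : K ≤ classStabilizer x) :
    Nat.card K ∣ classSize x :=
  card_dvd_classSize fun _ hk => hK hk

theorem mul_inv_mem_classStabilizer {x a b : G} (h : (classSize x).Coprime (classSize a))
    (hle : classSize (x * a) ≤ classSize x) (hb : IsConj a b) :
    b * a⁻¹ ∈ classStabilizer x :=
  fun _ hy => isConj_mul_conj_mul_inv h hle hy hb

theorem orderOf_dvd_classSize {x k : G} (hk : k ∈ classStabilizer x) :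
    orderOf k ∣ classSize x := by
  rw [← Nat.card_zpowers]
  exact card_dvd_classSize_of_le (by rwa [Subgroup.zpowers_le])

/-- With coprime class sizes, the class of `x * a` is at least as large as that of `x`. -/
theorem classSize_le_classSize_mul {x a : G} (h : (classSize x).Coprime (classSize a)) :
    classSize x ≤ classSize (x * a) := by
  rw [classSize_eq_ncard_isConj, classSize_eq_ncard_isConj,
    ← Set.ncard_image_of_injective _ (mul_left_injective a)]
  refine Set.ncard_le_ncard ?_
  rintro _ ⟨z, hz, rfl⟩
  obtain ⟨k, rfl, hk⟩ := exists_conj_of_coprime h hz (IsConj.refl a)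
  refine isConj_iff.2 ⟨k, ?_⟩
  conv_rhs => rw [← hk]
  group

/-- An element outside a subgroup has a power of prime power order outside this subgroup. -/
theorem exists_pow_notMem_of_primePow {Z : Subgroup G} {x : G} (hx : x ∉ Z) :
    ∃ q n k : ℕ, q.Prime ∧ q ∣ orderOf x ∧ x ^ n ∉ Z ∧ orderOf (x ^ n) = q ^ k := by
  induction hN : orderOf x using Nat.strong_induction_on generalizing x with
  | _ N ih =>
  have hx1 : N ≠ 1 := by
    rintro rfl
    exact hx (by rw [orderOf_eq_one_iff.1 hN]; exact Z.one_mem)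
  have hN0 : 0 < N := hN ▸ orderOf_pos x
  obtain ⟨q, hq, hqN⟩ := Nat.exists_prime_and_dvd hx1
  -- `x` is generated by its `q`-part and its `q'`-part. If the `q`-part lies in `Z`, the `q'`-part
  -- does not, and it has smaller order.
  by_cases hm : x ^ (N / q ^ N.factorization q) ∈ Z
  · have hv : x ^ (q ^ N.factorization q) ∉ Z := by
      intro hv
      apply hx
      have hcop : Nat.Coprime (q ^ N.factorization q) (N / q ^ N.factorization q) :=
        (Nat.coprime_ordCompl hq hN0.ne').pow_left _
      have := Subgroup.mul_mem _ (Subgroup.zpow_mem _ hv ((q ^ N.factorization q).gcdA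
        (N / q ^ N.factorization q))) (Subgroup.zpow_mem _ hm ((q ^ N.factorization q).gcdB
        (N / q ^ N.factorization q)))
      rw [← zpow_natCast, ← zpow_natCast, ← zpow_mul, ← zpow_mul, ← zpow_add,
        ← Nat.gcd_eq_gcd_ab, hcop.gcd_eq_one] at this
      simpa using this
    have hord : orderOf (x ^ (q ^ N.factorization q)) = N / q ^ N.factorization q := by
      rw [orderOf_pow_of_dvd (pow_ne_zero _ hq.ne_zero) (hN ▸ Nat.ordProj_dvd N q), hN]
    have hlt : N / q ^ N.factorization q < N := by
      refine Nat.div_lt_self hN0 (Nat.one_lt_pow ?_ hq.one_lt)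
      exact (hq.factorization_pos_of_dvd hN0.ne' hqN).ne'
    obtain ⟨q', n, k, h1, h2, h3, h4⟩ := ih _ hlt hv hord
    refine ⟨q', q ^ N.factorization q * n, k, h1, h2.trans (Nat.ordCompl_dvd N q), ?_, ?_⟩
    · rwa [pow_mul]
    · rwa [pow_mul]
  · refine ⟨q, _, N.factorization q, hq, hqN, hm, ?_⟩
    rw [orderOf_pow_of_dvd (Nat.pos_iff_ne_zero.1 (Nat.div_pos (Nat.le_of_dvd hN0
      (Nat.ordProj_dvd N q)) (pow_pos hq.pos _))) (by rw [hN]; exact Nat.ordCompl_dvd N q), hN,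
      Nat.div_div_self (Nat.ordProj_dvd N q) hN0.ne']

theorem IsPGroup.exists_sylow_le_of_not_dvd_index {s : ℕ} [hs : Fact s.Prime] {T C : Subgroup G}
    (hT : IsPGroup s T) (hTC : T ≤ C) (h : ¬ s ∣ C.index) :
    ∃ S : Sylow s G, T ≤ S ∧ (S : Subgroup G) ≤ C := by
  obtain ⟨S, hS⟩ := (hT.comap_subtype (K := C)).exists_le_sylow
  refine ⟨Sylow.ofCard ((S : Subgroup C).map C.subtype) ?_, ?_, ?_⟩
  · rw [Nat.card_congr ((S : Subgroup C).equivMapOfInjective _ C.subtype_injective).symm.toEquiv,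
      S.card_eq_multiplicity, ← C.card_mul_index,
      Nat.factorization_mul Nat.card_pos.ne' Subgroup.FiniteIndex.index_ne_zero]
    simp [Nat.factorization_eq_zero_of_not_dvd h]
  · rw [Sylow.coe_ofCard]
    exact fun t ht => ⟨⟨t, hTC ht⟩, hS ht, rfl⟩
  · rw [Sylow.coe_ofCard]
    exact Subgroup.map_subtype_le _

theorem exists_sylow_le_of_not_dvd_index {s : ℕ} [Fact s.Prime] {C : Subgroup G}
    (h : ¬ s ∣ C.index) : ∃ S : Sylow s G, (S : Subgroup G) ≤ C :=
  let ⟨S, _, hS⟩ := (IsPGroup.of_bot (p := s)).exists_sylow_le_of_not_dvd_index bot_le h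
  ⟨S, hS⟩

theorem exists_mem_sylow_notMem {s : ℕ} [hs : Fact s.Prime] {M : Subgroup G}
    (h : s ∣ M.index) (S : Sylow s G) : ∃ x ∈ S, x ∉ M := by
  by_contra! hc
  exact S.not_dvd_index (h.trans (Subgroup.index_dvd_of_le hc))

/-- A finite group is not the union of the conjugates of a proper subgroup. -/
theorem Subgroup.eq_top_of_forall_exists_conj_mem {J : Subgroup G}
    (h : ∀ g : G, ∃ k : G, k⁻¹ * g * k ∈ J) : J = ⊤ := by
  classical
  have := Fintype.ofFinite G
  by_contra hJ
  have := Fintype.ofFinite (G ⧸ J)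
  -- Burnside's count: a transitive action has one fixed point per element on average. Here every
  -- element fixes a coset, and `1` fixes several if `J` is proper.
  have hb := MulAction.sum_card_fixedBy_eq_card_orbits_mul_card_group G (G ⧸ J)
  have h1 : Fintype.card (Quotient (MulAction.orbitRel G (G ⧸ J))) = 1 := by
    rw [Fintype.card_eq_one_iff_nonempty_unique]
    have := (MulAction.pretransitive_iff_unique_quotient_of_nonempty G (G ⧸ J)).1 inferInstance
    exact this
  rw [h1, one_mul, Fintype.card_eq_sum_ones] at hb
  have hlt : ∑ _g : G, 1 < ∑ g : G, Fintype.card (MulAction.fixedBy (G ⧸ J) g) := by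
    refine Finset.sum_lt_sum (fun g _ => ?_) ⟨1, Finset.mem_univ _, ?_⟩
    · obtain ⟨k, hk⟩ := h g
      refine Fintype.card_pos_iff.2 ⟨⟨(k : G ⧸ J), ?_⟩⟩
      rw [MulAction.mem_fixedBy, MulAction.Quotient.smul_mk, eq_comm, QuotientGroup.eq]
      simpa [mul_assoc] using hk
    · rw [Fintype.one_lt_card_iff_nontrivial]
      have : Nontrivial (G ⧸ J) := by
        rw [QuotientGroup.nontrivial_iff]; exact hJ
      obtain ⟨a, b, hab⟩ := exists_pair_ne (G ⧸ J)
      exact ⟨⟨a, by simp⟩, ⟨b, by simp⟩, fun hh => hab (congrArg Subtype.val hh)⟩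
  exact hlt.ne hb.symm

end ClassSize

/-! ### `p`-separable groups: conjugating `p`-regular elements into a `p`-complement -/

section Separable

variable {G : Type*} [Group G] {p : ℕ}

theorem IsPSeparable.quotient (hG : IsPSeparable p G) (hp : p.Prime) (T : Subgroup G) [T.Normal] :
    IsPSeparable p (G ⧸ T) := by
  obtain ⟨n, N, h0, hn, hN, hstep⟩ := hG
  refine ⟨n, fun i => (N i).map (QuotientGroup.mk' T), ?_, ?_, ?_, ?_⟩
  · simp [h0]
  · simp only [hn]
    exact Subgroup.map_top_of_surjective _ (QuotientGroup.mk'_surjective T)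
  · intro i hi
    exact (hN i hi).map _ (QuotientGroup.mk'_surjective T)
  · intro i hi
    obtain ⟨hle, h⟩ := hstep i hi
    have hdvd : ((N i).map (QuotientGroup.mk' T)).relIndex ((N (i + 1)).map (QuotientGroup.mk' T))
        ∣ (N i).relIndex (N (i + 1)) := by
      rw [← Subgroup.relIndex_comap]
      exact Subgroup.relIndex_dvd_of_le_left _ (Subgroup.le_comap_map _ _)
    refine ⟨Subgroup.map_mono hle, ?_⟩
    rcases h with ⟨k, hk⟩ | h
    · left
      rw [hk] at hdvd
      obtain ⟨j, -, hj⟩ := (Nat.dvd_prime_pow hp).1 hdvd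
      exact ⟨j, hj⟩
    · right
      exact fun h' => h (h'.trans hdvd)

theorem IsPComplement.map_quotient [Finite G] {H : Subgroup G} (hH : IsPComplement p H) (hp : p.Prime)
    (T : Subgroup G) [T.Normal] : IsPComplement p (H.map (QuotientGroup.mk' T)) := by
  refine ⟨fun h => hH.1 (h.trans (Subgroup.card_map_dvd _ _)), ?_⟩
  obtain ⟨k, hk⟩ := hH.2
  have := Subgroup.index_map_dvd H (QuotientGroup.mk'_surjective T)
  rw [hk] at this
  obtain ⟨j, -, hj⟩ := (Nat.dvd_prime_pow hp).1 this
  exact ⟨j, hj⟩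

/-- The index of `C ∩ K` in `K` is that of `C` in `C K`. With `C` a centralizer, this compares a
class size with the order of `K`. -/
theorem Subgroup.relIndex_dvd_index_of_normal_right [Finite G] (C K : Subgroup G) [K.Normal] :
    C.relIndex K ∣ C.index := by
  have h1 : C.relIndex K * K.index = K.relIndex C * C.index := by
    rw [← Subgroup.inf_relIndex_right C K, Subgroup.relIndex_mul_index inf_le_right,
      ← Subgroup.inf_relIndex_left C K, Subgroup.relIndex_mul_index inf_le_left]
  have h2 : K.relIndex C * (C ⊔ K).index = K.index := by
    rw [← Subgroup.relIndex_sup_right, Subgroup.relIndex_mul_index le_sup_right]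
  refine ⟨(C ⊔ K).index, ?_⟩
  have h3 : K.relIndex C ≠ 0 := Subgroup.FiniteIndex.index_ne_zero
  apply Nat.eq_of_mul_eq_mul_left (Nat.pos_of_ne_zero h3)
  rw [← h1, ← h2]
  ring

/-- A normal subgroup of order prime to `p` lies in every `p`-complement. -/
theorem IsPComplement.le_of_normal [Finite G] {H : Subgroup G} (hH : IsPComplement p H)
    (hp : p.Prime) (T : Subgroup G) [T.Normal] (hT : ¬ p ∣ Nat.card T) : T ≤ H := by
  rw [← Subgroup.relIndex_eq_one]
  obtain ⟨k, hk⟩ := hH.2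
  have h1 : H.relIndex T ∣ p ^ k := by
    rw [← hk]
    exact Subgroup.relIndex_dvd_index_of_normal_right H T
  obtain ⟨j, -, hj⟩ := (Nat.dvd_prime_pow hp).1 h1
  rcases j with _ | j
  · simpa using hj
  · exact absurd ((Dvd.intro_left (p ^ j) (by rw [← pow_succ, hj])).trans
      (Subgroup.relIndex_dvd_card H T)) hT

/-- The first non-trivial term of the series serves if it is a `p'`-group; if it is a `p`-group, its
center does. -/
theorem IsPSeparable.exists_normal [Finite G] [Nontrivial G] (hG : IsPSeparable p G) (hp : p.Prime) :
    ∃ T : Subgroup G, T.Normal ∧ T ≠ ⊥ ∧ (¬ p ∣ Nat.card T ∨ (IsMulCommutative T ∧ IsPGroup p T)) := by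
  classical
  obtain ⟨n, N, h0, hn, hN, hstep⟩ := hG
  have hex : ∃ i, N i ≠ ⊥ := ⟨n, by rw [hn]; exact top_ne_bot⟩
  obtain ⟨i, hi⟩ : ∃ i, Nat.find hex = i + 1 :=
    Nat.exists_eq_succ_of_ne_zero fun h => (h ▸ Nat.find_spec hex) h0
  have hbot : N i = ⊥ := by
    by_contra h
    have := Nat.find_min' hex h
    omega
  have hne : N (i + 1) ≠ ⊥ := hi ▸ Nat.find_spec hex
  have hle : i < n := by
    have := Nat.find_min' hex (m := n) (by rw [hn]; exact top_ne_bot)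
    omega
  have hnorm : (N (i + 1)).Normal := hN _ hle
  obtain ⟨-, h⟩ := hstep i hle
  rw [hbot, Subgroup.relIndex_bot_left] at h
  rcases h with ⟨k, hk⟩ | h
  · have : Fact p.Prime := ⟨hp⟩
    have hpg : IsPGroup p (N (i + 1)) := IsPGroup.of_card hk
    have : Nontrivial (N (i + 1)) := (Subgroup.nontrivial_iff_ne_bot _).2 hne
    have hc := hpg.center_nontrivial
    refine ⟨(Subgroup.center (N (i + 1))).map (N (i + 1)).subtype, inferInstance, ?_, Or.inr ⟨?_, ?_⟩⟩
    · rw [Ne, Subgroup.map_eq_bot_iff_of_injective _ (N (i + 1)).subtype_injective]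
      exact (Subgroup.nontrivial_iff_ne_bot _).1 hc
    · infer_instance
    · exact (hpg.to_subgroup _).map _
  · exact ⟨_, hnorm, hne, Or.inl h⟩

/-- Two `p`-regular elements which are congruent modulo a normal abelian `p`-subgroup are
conjugate. -/
theorem isConj_of_mul_inv_mem [Finite G] (hp : p.Prime) {T : Subgroup G} [T.Normal] [hc : IsMulCommutative T]
    (hT : IsPGroup p T) {y h : G} (hy : ¬ p ∣ orderOf y) (hh : ¬ p ∣ orderOf h)
    (hyh : y * h⁻¹ ∈ T) : IsConj y h := by
  have : Fact p.Prime := ⟨hp⟩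
  have hmem : ∀ i : ℕ, y ^ i * (h ^ i)⁻¹ ∈ T := by
    intro i
    rw [← div_eq_mul_inv, ← QuotientGroup.eq_iff_div_mem, QuotientGroup.mk_pow,
      QuotientGroup.mk_pow, QuotientGroup.eq_iff_div_mem.2 (by rwa [div_eq_mul_inv])]
  set m := orderOf y * orderOf h with hm
  have hpm : ¬ p ∣ m := hp.prime.not_dvd_mul hy hh
  have hym : y ^ m = 1 := by rw [hm, pow_mul, pow_orderOf_eq_one, one_pow]
  have hhm : h ^ m = 1 := by rw [hm, mul_comm, pow_mul, pow_orderOf_eq_one, one_pow]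
  let _ : CommGroup T := { (inferInstance : Group T) with mul_comm := hc.is_comm.comm }
  -- A cocycle comparing `y` with `h`. The product `S` over the full period `m` makes `c 1 ^ m` a
  -- coboundary; as `m` is prime to the order of `T`, a power of `S` does so for `c 1` and gives the
  -- conjugating element.
  let c : ℕ → T := fun i => ⟨y ^ i * (h ^ i)⁻¹, hmem i⟩
  have hstep : ∀ i, c (i + 1) = MulAut.conjNormal y (c i) * c 1 := by
    intro i
    apply Subtype.ext
    rw [Subgroup.coe_mul, MulAut.conjNormal_apply]
    simp only [c, pow_succ', pow_zero]
    group
  set S : T := ∏ i ∈ Finset.range m, c i with hS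
  have hprod : S = MulAut.conjNormal y S * c 1 ^ m := by
    have h1 : ∏ i ∈ Finset.range m, c (i + 1) = S := by
      have h2 := Finset.prod_range_succ c m
      have h3 := Finset.prod_range_succ' c m
      have h4 : c m = 1 := Subtype.ext (by simp [c, hym, hhm])
      have h5 : c 0 = 1 := Subtype.ext (by simp [c])
      rw [h4, mul_one] at h2
      rw [h5, mul_one, h2] at h3
      exact h3.symm
    conv_lhs => rw [← h1]
    rw [Finset.prod_congr rfl fun i _ => hstep i, Finset.prod_mul_distrib, Finset.prod_const,
      Finset.card_range, ← map_prod]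
  obtain ⟨j, hj⟩ := IsPGroup.iff_card.1 hT
  have hcop : m.Coprime (Nat.card T) := by
    rw [hj]
    exact ((Nat.Prime.coprime_iff_not_dvd hp).2 hpm).symm.pow_right _
  obtain ⟨k, hk⟩ := exists_pow_eq_self_of_coprime (x := c 1)
    (hcop.coprime_dvd_right (orderOf_dvd_natCard _))
  have hfin : S ^ k = MulAut.conjNormal y (S ^ k) * c 1 := by
    conv_lhs => rw [hprod, mul_pow, hk, ← map_pow]
  have := congrArg Subtype.val hfin
  rw [Subgroup.coe_mul, MulAut.conjNormal_apply] at this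
  refine isConj_iff.2 ⟨((S ^ k : T) : G)⁻¹, ?_⟩
  simp only [c, pow_one] at this
  rw [inv_inv, mul_assoc, inv_mul_eq_iff_eq_mul]
  conv_rhs => rw [this]
  group

/-- In a `p`-separable group every `p`-regular element is conjugate to an element of any given
`p`-complement. -/
theorem IsPSeparable.exists_conj_mem [Finite G] (hp : p.Prime) (hG : IsPSeparable p G)
    {H : Subgroup G} (hH : IsPComplement p H) {x : G} (hx : ¬ p ∣ orderOf x) :
    ∃ g : G, g * x * g⁻¹ ∈ H := by
  induction hN : Nat.card G using Nat.strong_induction_on generalizing G with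
  | _ N ih =>
  rcases subsingleton_or_nontrivial G with hs | hs
  · exact ⟨1, by rw [Subsingleton.elim (1 * x * 1⁻¹) 1]; exact H.one_mem⟩
  obtain ⟨T, hTn, hT1, hT⟩ := hG.exists_normal hp
  have hlt : Nat.card (G ⧸ T) < N := by
    have h1 := T.card_mul_index
    rw [hN, Subgroup.index] at h1
    have h2 : 1 < Nat.card T := (Subgroup.one_lt_card_iff_ne_bot T).2 hT1
    have h3 : 0 < Nat.card (G ⧸ T) := Nat.card_pos
    nlinarith
  have hxq : ¬ p ∣ orderOf (x : G ⧸ T) := fun h =>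
    hx (h.trans (orderOf_map_dvd (QuotientGroup.mk' T) x))
  obtain ⟨g, hg⟩ := ih _ hlt (hG.quotient hp T) (hH.map_quotient hp T) hxq rfl
  obtain ⟨g, rfl⟩ := QuotientGroup.mk_surjective g
  obtain ⟨h, hhH, hh⟩ := hg
  have hmem : (g * x * g⁻¹) * h⁻¹ ∈ T := by
    rw [← div_eq_mul_inv, ← QuotientGroup.eq_iff_div_mem]
    exact hh.symm
  -- A conjugate of `x` agrees with `h ∈ H` modulo `T`. If `T` is a `p'`-group, it lies in `H`; if
  -- it is an abelian `p`-group, the conjugate of `x` is conjugate to `h`.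
  rcases hT with hT | ⟨hTc, hTp⟩
  · refine ⟨g, ?_⟩
    have := H.mul_mem (hH.le_of_normal hp T hT hmem) hhH
    simpa using this
  · have hy : ¬ p ∣ orderOf (g * x * g⁻¹) := by rwa [← (isConj_conj g x).orderOf_eq']
    have hh' : ¬ p ∣ orderOf h := fun h' => hH.1 (h'.trans (Subgroup.orderOf_dvd_natCard H hhH))
    obtain ⟨k, hk⟩ := isConj_iff.1 (isConj_of_mul_inv_mem hp hTp hy hh' hmem)
    refine ⟨k * g, ?_⟩
    have : k * g * x * (k * g)⁻¹ = h := by rw [← hk]; group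
    rwa [this]

end Separable

/-! ### Splittings of the `p`-regular classes and the abelian kernel -/

/-- The non-central `p`-regular elements of `G` split into the non-empty set `A`, which is a union
of connected components of the common divisor graph, and a rest which contains an element `b₀`
with a class of maximal size. -/
structure IsRegularSplitting (p : ℕ) {G : Type*} [Group G] (H : Subgroup G) (A : Set G) (b₀ : G) :
    Prop where
  prime : p.Prime
  isPComplement : IsPComplement p H
  conj_mem : ∀ x : G, ¬ p ∣ orderOf x → ∃ g : G, g * x * g⁻¹ ∈ H
  nonempty : A.Nonempty
  regular : ∀ a ∈ A, ¬ p ∣ orderOf a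
  noncentral : ∀ a ∈ A, a ∉ Subgroup.center G
  coprime : ∀ a ∈ A, ∀ x, ¬ p ∣ orderOf x → x ∉ Subgroup.center G → x ∉ A →
    (classSize a).Coprime (classSize x)
  regular_max : ¬ p ∣ orderOf b₀
  noncentral_max : b₀ ∉ Subgroup.center G
  notMem_max : b₀ ∉ A
  le_max : ∀ x, ¬ p ∣ orderOf x → x ∉ Subgroup.center G → classSize x ≤ classSize b₀
  no_triangle : ∀ x y z, ¬ p ∣ orderOf x → ¬ p ∣ orderOf y → ¬ p ∣ orderOf z →
    x ∉ Subgroup.center G → y ∉ Subgroup.center G → z ∉ Subgroup.center G →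
    ∀ q : ℕ, q.Prime → q ∣ classSize x → q ∣ classSize y → q ∣ classSize z →
    IsConj x y ∨ IsConj y z ∨ IsConj x z

theorem Subgroup.closure_normal_of_conj_mem {G : Type*} [Group G] {S : Set G}
    (hS : ∀ x ∈ S, ∀ g : G, g * x * g⁻¹ ∈ S) : (Subgroup.closure S).Normal := by
  refine ⟨fun n hn g => ?_⟩
  induction hn using Subgroup.closure_induction with
  | mem x hx => exact Subgroup.subset_closure (hS x hx g)
  | one => simp
  | mul x y _ _ hx hy =>
    have := mul_mem hx hy
    rwa [show g * x * g⁻¹ * (g * y * g⁻¹) = g * (x * y) * g⁻¹ by group] at this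
  | inv x _ hx =>
    have := inv_mem hx
    rwa [show (g * x * g⁻¹)⁻¹ = g * x⁻¹ * g⁻¹ by group] at this

/-- The subgroup generated by `A` and the central `p`-regular elements. -/
def regularKernel (p : ℕ) {G : Type*} [Group G] (A : Set G) : Subgroup G :=
  Subgroup.closure (A ∪ {z | z ∈ Subgroup.center G ∧ ¬ p ∣ orderOf z})

/-- The subgroup generated by the quotients of conjugate elements of `A`. -/
def quotientClosure {G : Type*} [Group G] (A : Set G) : Subgroup G :=
  Subgroup.closure {k | ∃ a ∈ A, ∃ b, IsConj a b ∧ k = b * a⁻¹}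

namespace IsRegularSplitting

variable {p : ℕ} {G : Type*} [Group G] {H : Subgroup G} {A : Set G} {b₀ : G}

theorem classSize_ne_one {x : G} (hx : x ∉ Subgroup.center G) : classSize x ≠ 1 :=
  fun h => hx (classSize_eq_one_iff.1 h)

theorem mem_of_not_coprime (h : IsRegularSplitting p H A b₀) {a x : G} (ha : a ∈ A)
    (hx : ¬ p ∣ orderOf x) (hxc : x ∉ Subgroup.center G)
    (hn : ¬ (classSize a).Coprime (classSize x)) : x ∈ A := by
  by_contra hxA
  exact hn (h.coprime a ha x hx hxc hxA)

theorem mem_of_dvd (h : IsRegularSplitting p H A b₀) {a x : G} (ha : a ∈ A)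
    (hx : ¬ p ∣ orderOf x) (hxc : x ∉ Subgroup.center G)
    (hd : classSize x ∣ classSize a) : x ∈ A := by
  refine h.mem_of_not_coprime ha hx hxc fun hc => classSize_ne_one hxc ?_
  have := hc.coprime_dvd_left hd
  simpa using this

theorem mem_of_dvd' (h : IsRegularSplitting p H A b₀) {a x : G} (ha : a ∈ A)
    (hx : ¬ p ∣ orderOf x) (hxc : x ∉ Subgroup.center G)
    (hd : classSize a ∣ classSize x) : x ∈ A := by
  refine h.mem_of_not_coprime ha hx hxc fun hc => classSize_ne_one (h.noncentral a ha) ?_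
  have := hc.coprime_dvd_right hd
  simpa using this

theorem mem_center_of_isConj {a b : G} (hab : IsConj a b) (ha : a ∈ Subgroup.center G) :
    b ∈ Subgroup.center G := by
  rwa [← classSize_eq_one_iff, ← hab.classSize_eq, classSize_eq_one_iff]

theorem mem_of_isConj (h : IsRegularSplitting p H A b₀) {a b : G} (ha : a ∈ A)
    (hab : IsConj a b) : b ∈ A :=
  h.mem_of_dvd ha (hab.orderOf_eq' ▸ h.regular a ha)
    (fun hb => h.noncentral a ha (mem_center_of_isConj hab.symm hb)) (by rw [hab.classSize_eq])

theorem quotientClosure_normal (h : IsRegularSplitting p H A b₀) : (quotientClosure A).Normal := by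
  refine Subgroup.closure_normal_of_conj_mem ?_
  rintro _ ⟨a, ha, b, hb, rfl⟩ g
  refine ⟨g * a * g⁻¹, h.mem_of_isConj ha (isConj_conj g a), g * b * g⁻¹, ?_, by group⟩
  exact (isConj_conj g a).symm.trans (hb.trans (isConj_conj g b))

theorem mem_kernel {a : G} (ha : a ∈ A) : a ∈ regularKernel p A :=
  Subgroup.subset_closure (Or.inl ha)

theorem mem_kernel_of_mem_center {a : G} (ha : a ∈ Subgroup.center G) (ha' : ¬ p ∣ orderOf a) :
    a ∈ regularKernel p A :=
  Subgroup.subset_closure (Or.inr ⟨ha, ha'⟩)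

/-- This is why the central `p`-regular elements belong to the kernel: the hypotheses on non-central
elements apply to all `p`-regular elements outside it. -/
theorem notMem_center_of_notMem_kernel {x : G} (hx : ¬ p ∣ orderOf x)
    (hxM : x ∉ regularKernel p A) : x ∉ Subgroup.center G :=
  fun hc => hxM (mem_kernel_of_mem_center hc hx)

theorem notMem_of_notMem_kernel {x : G} (hxM : x ∉ regularKernel p A) : x ∉ A :=
  fun hx => hxM (mem_kernel hx)

theorem kernel_normal (h : IsRegularSplitting p H A b₀) : (regularKernel p A).Normal := by
  refine Subgroup.closure_normal_of_conj_mem ?_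
  rintro x (hx | ⟨hx, hx'⟩) g
  · exact Or.inl (h.mem_of_isConj hx (isConj_conj g x))
  · refine Or.inr ?_
    rw [Subgroup.mem_center_iff.1 hx g, mul_inv_cancel_right]
    exact ⟨hx, hx'⟩

variable [Finite G]

/-- Coprime class sizes allow `x` and `y` to be conjugated into `H` simultaneously, although they
need not commute. -/
theorem regular_mul (h : IsRegularSplitting p H A b₀) {x y : G} (hx : ¬ p ∣ orderOf x)
    (hy : ¬ p ∣ orderOf y) (hc : (classSize x).Coprime (classSize y)) : ¬ p ∣ orderOf (x * y) := by
  obtain ⟨g, hg⟩ := h.conj_mem x hx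
  obtain ⟨k, hk⟩ := h.conj_mem y hy
  obtain ⟨l, hl1, hl2⟩ := exists_conj_of_coprime hc (isConj_conj g x) (isConj_conj k y)
  have hmem : l * (x * y) * l⁻¹ ∈ H := by
    have := H.mul_mem hg hk
    rw [← hl1, ← hl2] at this
    rwa [show l * x * l⁻¹ * (l * y * l⁻¹) = l * (x * y) * l⁻¹ by group] at this
  rw [(isConj_conj l (x * y)).orderOf_eq']
  exact fun h' => h.isPComplement.1 (h'.trans (Subgroup.orderOf_dvd_natCard H hmem))

theorem classSize_mul_le_max (h : IsRegularSplitting p H A b₀) {a : G} (ha : a ∈ A) :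
    classSize (b₀ * a) ≤ classSize b₀ := by
  have hc := (h.coprime a ha b₀ h.regular_max h.noncentral_max h.notMem_max).symm
  refine h.le_max _ (h.regular_mul h.regular_max (h.regular a ha) hc) fun hz => ?_
  have := classSize_le_classSize_mul hc
  rw [classSize_eq_one_iff.2 hz] at this
  exact classSize_ne_one h.noncentral_max (le_antisymm this (classSize_pos b₀))

/-- The class size of `x * a` divides the product of the two sizes. As `x * a` lies outside `A`, it
is coprime to that of `a`, hence divides that of `x`. -/
theorem classSize_mul_le (h : IsRegularSplitting p H A b₀) {a x : G} (ha : a ∈ A)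
    (hx : ¬ p ∣ orderOf x) (hxc : x ∉ Subgroup.center G) (hxA : x ∉ A) (hxa : x * a ∉ A) :
    classSize (x * a) ≤ classSize x := by
  have hc := (h.coprime a ha x hx hxc hxA).symm
  refine Nat.le_of_dvd (classSize_pos x) ?_
  have hnc : x * a ∉ Subgroup.center G := fun hz => by
    have := classSize_le_classSize_mul hc
    rw [classSize_eq_one_iff.2 hz] at this
    exact classSize_ne_one hxc (le_antisymm this (classSize_pos x))
  exact (h.coprime a ha _ (h.regular_mul hx (h.regular a ha) hc) hnc hxa).symm.dvd_of_dvd_mul_right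
    (classSize_mul_dvd_of_coprime hc)

theorem card_quotientClosure_dvd (h : IsRegularSplitting p H A b₀) :
    Nat.card (quotientClosure A) ∣ classSize b₀ := by
  refine card_dvd_classSize_of_le ((Subgroup.closure_le _).2 ?_)
  rintro _ ⟨a, ha, b, hb, rfl⟩
  exact mul_inv_mem_classStabilizer
    (h.coprime a ha b₀ h.regular_max h.noncentral_max h.notMem_max).symm
    (h.classSize_mul_le_max ha) hb

theorem coprime_card_quotientClosure (h : IsRegularSplitting p H A b₀) {a : G} (ha : a ∈ A) :
    (classSize a).Coprime (Nat.card (quotientClosure A)) :=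
  (h.coprime a ha b₀ h.regular_max h.noncentral_max h.notMem_max).coprime_dvd_right
    h.card_quotientClosure_dvd

/-- The index of the centralizer of `a` in this normal subgroup divides two coprime numbers,
`classSize a` and the order of the subgroup. -/
theorem quotientClosure_le_centralizer (h : IsRegularSplitting p H A b₀) {a : G} (ha : a ∈ A) :
    quotientClosure A ≤ Subgroup.centralizer {a} := by
  have := h.quotientClosure_normal
  rw [← Subgroup.relIndex_eq_one]
  exact Nat.eq_one_of_dvd_coprimes (h.coprime_card_quotientClosure ha)
    (Subgroup.relIndex_dvd_index_of_normal_right _ _) (Subgroup.relIndex_dvd_card _ _)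

theorem commute_of_mem_quotientClosure (h : IsRegularSplitting p H A b₀) {a k : G} (ha : a ∈ A)
    (hk : k ∈ quotientClosure A) : Commute k a :=
  Subgroup.mem_centralizer_singleton_iff.1 (h.quotientClosure_le_centralizer ha hk)

theorem commute_of_mem (h : IsRegularSplitting p H A b₀) {a b : G} (ha : a ∈ A) (hb : b ∈ A) :
    Commute a b := by
  have hcomm : ∀ m ∈ Subgroup.closure A, ∀ k ∈ quotientClosure A, Commute k m := by
    intro m hm k hk
    induction hm using Subgroup.closure_induction with
    | mem x hx => exact h.commute_of_mem_quotientClosure hx hk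
    | one => exact Commute.one_right k
    | mul x y _ _ hx hy => exact hx.mul_right hy
    | inv x _ hx => exact hx.inv_right
  have hmem : ∀ m : G, m * a * m⁻¹ * a⁻¹ ∈ quotientClosure A := fun m =>
    Subgroup.subset_closure ⟨a, ha, _, isConj_conj m a, rfl⟩
  -- The commutator with `a` is a homomorphism because its values centralize `A`. The index of its
  -- kernel, the centralizer of `a`, again divides two coprime numbers.
  let φ : Subgroup.closure A →* quotientClosure A :=
    { toFun := fun m => ⟨m * a * (m : G)⁻¹ * a⁻¹, hmem m⟩
      map_one' := Subtype.ext (by simp)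
      map_mul' := by
        intro m n
        apply Subtype.ext
        change (m * n : G) * a * (m * n : G)⁻¹ * a⁻¹ =
          (m * a * (m : G)⁻¹ * a⁻¹) * (n * a * (n : G)⁻¹ * a⁻¹)
        have h1 := hcomm m m.2 _ (hmem n)
        have h2 := h.commute_of_mem_quotientClosure ha (hmem n)
        have h3 : Commute ((n * a * (n : G)⁻¹ * a⁻¹)) (a * (m : G)⁻¹ * a⁻¹) :=
          (h2.mul_right h1.inv_right).mul_right h2.inv_right
        calc (m * n : G) * a * (m * n : G)⁻¹ * a⁻¹
            = m * ((n * a * (n : G)⁻¹ * a⁻¹) * (a * (m : G)⁻¹ * a⁻¹)) := by group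
          _ = _ := by rw [h3.eq]; group }
  have hn : (Subgroup.closure A).Normal :=
    Subgroup.closure_normal_of_conj_mem fun x hx g => h.mem_of_isConj hx (isConj_conj g x)
  have hker : φ.ker = (Subgroup.centralizer {a}).subgroupOf (Subgroup.closure A) := by
    ext m
    rw [MonoidHom.mem_ker, Subgroup.mem_subgroupOf, Subgroup.mem_centralizer_singleton_iff,
      Subtype.ext_iff]
    change (m * a * (m : G)⁻¹ * a⁻¹ : G) = 1 ↔ _
    rw [mul_inv_eq_one, mul_inv_eq_iff_eq_mul]
  have hone : (Subgroup.centralizer {a}).relIndex (Subgroup.closure A) = 1 := by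
    refine Nat.eq_one_of_dvd_coprimes (h.coprime_card_quotientClosure ha)
      (Subgroup.relIndex_dvd_index_of_normal_right _ _) ?_
    rw [Subgroup.relIndex, ← hker, Subgroup.index_ker]
    exact Subgroup.card_subgroup_dvd_card _
  have := Subgroup.relIndex_eq_one.1 hone (Subgroup.subset_closure hb)
  exact (Subgroup.mem_centralizer_singleton_iff.1 this).symm

theorem kernel_isMulCommutative (h : IsRegularSplitting p H A b₀) :
    IsMulCommutative (regularKernel p A) := by
  refine Subgroup.isMulCommutative_closure ?_
  rintro x (hx | ⟨hx, -⟩) y hy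
  · rcases hy with hy | ⟨hy, -⟩
    · exact h.commute_of_mem hx hy
    · exact Subgroup.mem_center_iff.1 hy x
  · exact (Subgroup.mem_center_iff.1 hx y).symm

theorem commute_of_mem_kernel (h : IsRegularSplitting p H A b₀) {x y : G}
    (hx : x ∈ regularKernel p A) (hy : y ∈ regularKernel p A) : Commute x y := by
  have := h.kernel_isMulCommutative
  exact congrArg Subtype.val (this.is_comm.comm ⟨x, hx⟩ ⟨y, hy⟩)

theorem regular_of_mem_kernel (h : IsRegularSplitting p H A b₀) {x : G}
    (hx : x ∈ regularKernel p A) : ¬ p ∣ orderOf x := by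
  induction hx using Subgroup.closure_induction with
  | mem x hx =>
    rcases hx with hx | ⟨-, hx⟩
    · exact h.regular x hx
    · exact hx
  | one => simpa using h.prime.ne_one
  | mul _ _ hx hy ihx ihy =>
    intro hd
    have := hd.trans (h.commute_of_mem_kernel hx hy).orderOf_mul_dvd_mul_orderOf
    exact h.prime.prime.not_dvd_mul ihx ihy this
  | inv x _ ih => rwa [orderOf_inv]

theorem card_kernel (h : IsRegularSplitting p H A b₀) : ¬ p ∣ Nat.card (regularKernel p A) := by
  intro hd
  have : Fact p.Prime := ⟨h.prime⟩
  obtain ⟨x, hx⟩ := exists_prime_orderOf_dvd_card' p hd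
  refine h.regular_of_mem_kernel x.2 ?_
  rw [Subgroup.orderOf_coe, hx]

theorem kernel_le (h : IsRegularSplitting p H A b₀) : regularKernel p A ≤ H := by
  have := h.kernel_normal
  exact h.isPComplement.le_of_normal h.prime _ h.card_kernel

theorem classSize_dvd_index_kernel (h : IsRegularSplitting p H A b₀) {x : G}
    (hx : x ∈ regularKernel p A) : classSize x ∣ (regularKernel p A).index :=
  Subgroup.index_dvd_of_le fun _ hy =>
    Subgroup.mem_centralizer_singleton_iff.2 (h.commute_of_mem_kernel hy hx)

/-- A non-central element of prime power order of the kernel has a conjugate such that the prime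
divides the order of the quotient. -/
theorem exists_isConj_dvd_orderOf (h : IsRegularSplitting p H A b₀) {x : G}
    (hx : x ∈ regularKernel p A) (hxc : x ∉ Subgroup.center G) {q k : ℕ} (hq : q.Prime)
    (hk : orderOf x = q ^ k) : ∃ b, IsConj x b ∧ q ∣ orderOf (b * x⁻¹) := by
  obtain ⟨g, hg⟩ : ∃ g, g * x ≠ x * g := by
    by_contra! hc
    exact hxc (Subgroup.mem_center_iff.2 hc)
  have hn := h.kernel_normal
  have hcomm : Commute (g * x * g⁻¹) x⁻¹ :=
    (h.commute_of_mem_kernel (hn.conj_mem x hx g) hx).inv_right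
  refine ⟨g * x * g⁻¹, isConj_conj g x, ?_⟩
  have hd : orderOf (g * x * g⁻¹ * x⁻¹) ∣ q ^ k := by
    rw [orderOf_dvd_iff_pow_eq_one, hcomm.mul_pow, ← hk, inv_pow, pow_orderOf_eq_one,
      (isConj_conj g x).orderOf_eq', pow_orderOf_eq_one, inv_one, mul_one]
  obtain ⟨j, -, hj⟩ := (Nat.dvd_prime_pow hq).1 hd
  rcases j with _ | j
  · rw [pow_zero, orderOf_eq_one_iff, mul_inv_eq_one, mul_inv_eq_iff_eq_mul] at hj
    exact absurd hj hg
  · exact hj ▸ dvd_pow_self q j.succ_ne_zero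

/-- Some quotient of conjugates of `a` has order divisible by `q`, so `q` divides the order of
`quotientClosure A`, which is coprime to `classSize a`. -/
theorem not_dvd_classSize_of_orderOf (h : IsRegularSplitting p H A b₀) {a : G} (ha : a ∈ A)
    {q k : ℕ} (hq : q.Prime) (hk : orderOf a = q ^ k) : ¬ q ∣ classSize a := by
  obtain ⟨b, hb, hqb⟩ := h.exists_isConj_dvd_orderOf (mem_kernel ha) (h.noncentral a ha) hq hk
  have h1 : q ∣ Nat.card (quotientClosure A) := hqb.trans
    (Subgroup.orderOf_dvd_natCard _ (Subgroup.subset_closure ⟨a, ha, b, hb, rfl⟩))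
  exact fun h2 => Nat.not_coprime_of_dvd_of_dvd hq.one_lt h2 h1 (h.coprime_card_quotientClosure ha)

/-- Since `x * a` is outside `A`, the class of `x` is stable under a quotient of conjugates of `a`
of order divisible by `q`. So all `p`-regular classes outside the kernel share the prime `q`. -/
theorem dvd_classSize_of_notMem_kernel (h : IsRegularSplitting p H A b₀) {a x : G} (ha : a ∈ A)
    {q k : ℕ} (hq : q.Prime) (hk : orderOf a = q ^ k) (hx : ¬ p ∣ orderOf x)
    (hxM : x ∉ regularKernel p A) : q ∣ classSize x := by
  obtain ⟨b, hb, hqb⟩ := h.exists_isConj_dvd_orderOf (mem_kernel ha) (h.noncentral a ha) hq hk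
  have hxc := notMem_center_of_notMem_kernel hx hxM
  have hxa : x * a ∉ A := fun hh =>
    hxM ((Subgroup.mul_mem_cancel_right _ (mem_kernel ha)).1 (mem_kernel hh))
  refine hqb.trans (orderOf_dvd_classSize (mul_inv_mem_classStabilizer
    (h.coprime a ha x hx hxc (notMem_of_notMem_kernel hxM)).symm
    (h.classSize_mul_le ha hx hxc (notMem_of_notMem_kernel hxM) hxa) hb))

/-- `A` contains elements of prime power order. -/
theorem exists_pow_mem (h : IsRegularSplitting p H A b₀) {a : G} (ha : a ∈ A) :
    ∃ q n k : ℕ, q.Prime ∧ q ≠ p ∧ a ^ n ∈ A ∧ orderOf (a ^ n) = q ^ k := by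
  obtain ⟨q, n, k, hq, hqa, hn, hk⟩ := exists_pow_notMem_of_primePow (h.noncentral a ha)
  refine ⟨q, n, k, hq, ?_, ?_, hk⟩
  · rintro rfl
    exact h.regular a ha hqa
  · exact h.mem_of_dvd ha (fun h' => h.regular a ha (h'.trans (orderOf_pow_dvd n))) hn
      (classSize_pow_dvd a n)

/-- Among three `p`-regular elements outside of the kernel two are conjugate. -/
theorem isConj_of_notMem_kernel (h : IsRegularSplitting p H A b₀) {x y z : G}
    (hx : ¬ p ∣ orderOf x) (hy : ¬ p ∣ orderOf y) (hz : ¬ p ∣ orderOf z)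
    (hxM : x ∉ regularKernel p A) (hyM : y ∉ regularKernel p A) (hzM : z ∉ regularKernel p A) :
    IsConj x y ∨ IsConj y z ∨ IsConj x z := by
  obtain ⟨a, ha⟩ := h.nonempty
  obtain ⟨q, n, k, hq, -, hmem, hk⟩ := h.exists_pow_mem ha
  exact h.no_triangle x y z hx hy hz (notMem_center_of_notMem_kernel hx hxM)
    (notMem_center_of_notMem_kernel hy hyM) (notMem_center_of_notMem_kernel hz hzM) q hq
    (h.dvd_classSize_of_notMem_kernel hmem hq hk hx hxM)
    (h.dvd_classSize_of_notMem_kernel hmem hq hk hy hyM)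
    (h.dvd_classSize_of_notMem_kernel hmem hq hk hz hzM)

end IsRegularSplitting

/-! ### Elements outside the kernel and the primes dividing its index -/

/-- If `β` is an automorphism of `q`-power order of a finite abelian group `V` and `W` is a
`β`-invariant subgroup with `V = [V, β] W`, then `W` contains all `q`-elements of `V`. -/
theorem mem_of_forall_exists_commutator_mul {V : Type*} [CommGroup V] [Finite V] {q : ℕ}
    (hq : q.Prime) {β : MulAut V} {i : ℕ} (hβ : β ^ q ^ i = 1) {W : Subgroup V}
    (hW : W.map (β : V →* V) = W) (h : ∀ u : V, ∃ v, ∃ w ∈ W, u = β v * v⁻¹ * w) {a : V} {k : ℕ}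
    (ha : a ^ q ^ k = 1) : a ∈ W := by
  have : Fact q.Prime := ⟨hq⟩
  by_contra haW
  let γ : MulAut (V ⧸ W) := QuotientGroup.congr W W β hW
  have hγ : ∀ v : V, γ (v : V ⧸ W) = (β v : V ⧸ W) := fun _ => rfl
  have hγn : ∀ (n : ℕ) (v : V), (γ ^ n) (v : V ⧸ W) = ((β ^ n) v : V ⧸ W) := by
    intro n
    induction n with
    | zero => intro v; rfl
    | succ n ih => intro v; rw [pow_succ, pow_succ, MulAut.mul_apply, MulAut.mul_apply, hγ, ih]
  have hγq : γ ^ q ^ i = 1 := by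
    ext x
    obtain ⟨v, rfl⟩ := QuotientGroup.mk_surjective x
    rw [hγn, hβ]
    rfl
  have hpg : IsPGroup q (Subgroup.zpowers γ) := by
    obtain ⟨j, -, hj⟩ := (Nat.dvd_prime_pow hq).1 (orderOf_dvd_of_pow_eq_one hγq)
    exact IsPGroup.of_card (n := j) (by rw [Nat.card_zpowers, hj])
  have hdvd : q ∣ Nat.card (V ⧸ W) := by
    have h1 : orderOf (a : V ⧸ W) ∣ q ^ k := by
      rw [orderOf_dvd_iff_pow_eq_one, ← QuotientGroup.mk_pow, ha]
      rfl
    obtain ⟨j, -, hj⟩ := (Nat.dvd_prime_pow hq).1 h1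
    rcases j with _ | j
    · rw [pow_zero, orderOf_eq_one_iff, QuotientGroup.eq_one_iff] at hj
      exact absurd hj haW
    · exact ((dvd_pow_self q j.succ_ne_zero).trans hj.symm.dvd).trans (orderOf_dvd_natCard _)
  -- `F` is onto, hence injective, so `γ` fixes only `1`. But a `q`-group acting on a group of order
  -- divisible by `q` fixes more.
  let F : V ⧸ W → V ⧸ W := fun x => γ x * x⁻¹
  have hsurj : Function.Surjective F := by
    intro x
    obtain ⟨u, rfl⟩ := QuotientGroup.mk_surjective x
    obtain ⟨v, w, hw, rfl⟩ := h u
    refine ⟨(v : V ⧸ W), ?_⟩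
    change γ (v : V ⧸ W) * (v : V ⧸ W)⁻¹ = _
    rw [hγ, ← QuotientGroup.mk_inv, ← QuotientGroup.mk_mul, eq_comm, ← inv_inj,
      ← QuotientGroup.mk_inv, ← QuotientGroup.mk_inv, QuotientGroup.eq]
    simpa [mul_comm, mul_assoc, mul_left_comm] using hw
  have hinj : Function.Injective F := Finite.injective_iff_surjective.2 hsurj
  have h1 : (1 : V ⧸ W) ∈ MulAction.fixedPoints (Subgroup.zpowers γ) (V ⧸ W) :=
    fun g => map_one (g : MulAut (V ⧸ W))
  obtain ⟨x, hx, hne⟩ := hpg.exists_fixed_point_of_prime_dvd_card_of_fixed_point _ hdvd h1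
  have hfx : γ x = x := hx ⟨γ, Subgroup.mem_zpowers γ⟩
  refine hne (hinj ?_)
  change γ 1 * 1⁻¹ = γ x * x⁻¹
  rw [hfx, map_one, inv_one, mul_one, mul_inv_cancel]

namespace IsRegularSplitting

variable {p : ℕ} {G : Type*} [Group G] {H : Subgroup G} {A : Set G} {b₀ : G}

theorem regular_of_orderOf_eq (h : IsRegularSplitting p H A b₀) {x : G} {t k : ℕ} (ht : t.Prime)
    (htp : t ≠ p) (hx : orderOf x = t ^ k) : ¬ p ∣ orderOf x := by
  rw [hx]
  exact fun hd => htp ((Nat.prime_dvd_prime_iff_eq h.prime ht).1 (h.prime.dvd_of_dvd_pow hd)).symm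

theorem mem_kernel_of_coprime (h : IsRegularSplitting p H A b₀) {x : G}
    (hx : (orderOf x).Coprime (regularKernel p A).index) : x ∈ regularKernel p A := by
  have := h.kernel_normal
  obtain ⟨m, hm⟩ := exists_pow_eq_self_of_coprime hx.symm
  rw [← hm]
  exact pow_mem (Subgroup.pow_index_mem _ x) m

theorem not_dvd_classSize_of_notMem_kernel (h : IsRegularSplitting p H A b₀) {a x : G}
    (ha : a ∈ A) {s : ℕ} (hs : s.Prime) (hsa : s ∣ classSize a) (hx : ¬ p ∣ orderOf x)
    (hxM : x ∉ regularKernel p A) : ¬ s ∣ classSize x :=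
  fun hsx => Nat.not_coprime_of_dvd_of_dvd hs.one_lt hsa hsx
    (h.coprime a ha x hx (notMem_center_of_notMem_kernel hx hxM) (notMem_of_notMem_kernel hxM))

theorem not_dvd_orderOf_mul (h : IsRegularSplitting p H A b₀) {x y : G} (hxy : Commute x y)
    (hx : ¬ p ∣ orderOf x) (hy : ¬ p ∣ orderOf y) : ¬ p ∣ orderOf (x * y) :=
  fun hd => h.prime.prime.not_dvd_mul hx hy (hd.trans hxy.orderOf_mul_dvd_mul_orderOf)

/-- A `p`-regular element outside of the kernel does not commute with elements of `A` of coprime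
order. -/
theorem not_commute_of_coprime (h : IsRegularSplitting p H A b₀) {a x : G} (ha : a ∈ A)
    (hx : ¬ p ∣ orderOf x) (hxM : x ∉ regularKernel p A)
    (hc : (orderOf x).Coprime (orderOf a)) : ¬ Commute x a := by
  intro hxa
  have hreg := h.not_dvd_orderOf_mul hxa hx (h.regular a ha)
  have hxaM : x * a ∉ regularKernel p A := fun hh =>
    hxM ((Subgroup.mul_mem_cancel_right _ (mem_kernel ha)).1 hh)
  exact notMem_of_notMem_kernel hxaM
    (h.mem_of_dvd' ha hreg (notMem_center_of_notMem_kernel hreg hxaM) (hxa.classSize_dvd_mul hc).2)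

variable [Finite G]

theorem regular_mul_kernel (h : IsRegularSplitting p H A b₀) {x u : G} (hx : ¬ p ∣ orderOf x)
    (hu : u ∈ regularKernel p A) : ¬ p ∣ orderOf (x * u) := by
  obtain ⟨g, hg⟩ := h.conj_mem x hx
  have hmem : g * (x * u) * g⁻¹ ∈ H := by
    have := H.mul_mem hg (h.kernel_le (h.kernel_normal.conj_mem u hu g))
    rwa [show g * x * g⁻¹ * (g * u * g⁻¹) = g * (x * u) * g⁻¹ by group] at this
  rw [(isConj_conj g (x * u)).orderOf_eq']
  exact fun h' => h.isPComplement.1 (h'.trans (Subgroup.orderOf_dvd_natCard H hmem))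

/-- A subgroup whose index is not divisible by a prime divisor `t` of the index of the kernel
contains `t`-elements outside of the kernel. -/
theorem exists_mem_notMem_kernel {t : ℕ} (ht : t.Prime) (hd : t ∣ (regularKernel p A).index)
    {C : Subgroup G} (hC : ¬ t ∣ C.index) :
    ∃ x ∈ C, x ∉ regularKernel p A ∧ ∃ k, orderOf x = t ^ k := by
  have : Fact t.Prime := ⟨ht⟩
  obtain ⟨S, hS⟩ := exists_sylow_le_of_not_dvd_index hC
  obtain ⟨x, hx, hxM⟩ := exists_mem_sylow_notMem hd S
  exact ⟨x, hS hx, hxM, S.exists_orderOf_eq_pow hx⟩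

/-- Otherwise the index of the kernel is a power of `p`, so `p` divides the class sizes of both `b₀`
and any element of `A`. -/
theorem exists_regular_notMem_kernel (h : IsRegularSplitting p H A b₀) :
    ∃ x, ¬ p ∣ orderOf x ∧ x ∉ regularKernel p A := by
  by_contra! hc
  have hindex : ∀ t : ℕ, t.Prime → t ∣ (regularKernel p A).index → t = p := by
    intro t ht hd
    by_contra htp
    obtain ⟨x, -, hx, k, hk⟩ := exists_mem_notMem_kernel ht hd (C := ⊤)
      (by rw [Subgroup.index_top]; exact ht.one_lt.ne' ∘ Nat.dvd_one.1)
    exact hx (hc x (h.regular_of_orderOf_eq ht htp hk))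
  have hp : ∀ x ∈ regularKernel p A, x ∉ Subgroup.center G → p ∣ classSize x := by
    intro x hx hxc
    obtain ⟨t, ht, htx⟩ := Nat.exists_prime_and_dvd (classSize_ne_one hxc)
    exact hindex t ht (htx.trans (h.classSize_dvd_index_kernel hx)) ▸ htx
  obtain ⟨a, ha⟩ := h.nonempty
  exact Nat.not_coprime_of_dvd_of_dvd h.prime.one_lt (hp a (mem_kernel ha) (h.noncentral a ha))
    (hp b₀ (hc _ h.regular_max) h.noncentral_max)
    (h.coprime a ha b₀ h.regular_max h.noncentral_max h.notMem_max)

/-- Otherwise a `t`-element `b` outside the kernel has class size prime to `s`, so it commutes with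
an `s`-element `x` outside the kernel. The orders of `b`, `x` and `b * x` differ, giving a triangle.
-/
theorem eq_of_dvd_index_kernel (h : IsRegularSplitting p H A b₀) {a : G} (ha : a ∈ A) {s t : ℕ}
    (hs : s.Prime) (hsp : s ≠ p) (hsa : s ∣ classSize a) (ht : t.Prime) (htp : t ≠ p)
    (htM : t ∣ (regularKernel p A).index) : t = s := by
  by_contra hts
  obtain ⟨b, -, hbM, i, hi⟩ := exists_mem_notMem_kernel ht htM (C := ⊤)
    (by rw [Subgroup.index_top]; exact ht.one_lt.ne' ∘ Nat.dvd_one.1)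
  have hb := h.regular_of_orderOf_eq ht htp hi
  obtain ⟨x, hxb, hxM, j, hj⟩ := exists_mem_notMem_kernel hs
    (hsa.trans (h.classSize_dvd_index_kernel (mem_kernel ha)))
    (h.not_dvd_classSize_of_notMem_kernel ha hs hsa hb hbM)
  have hx := h.regular_of_orderOf_eq hs hsp hj
  have hcomm : Commute b x := (Subgroup.mem_centralizer_singleton_iff.1 hxb).symm
  have hcop : (orderOf b).Coprime (orderOf x) := by
    rw [hi, hj]
    exact Nat.Coprime.pow _ _ ((Nat.coprime_primes ht hs).2 hts)
  have hbxM : b * x ∉ regularKernel p A := by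
    intro hh
    obtain ⟨n, hn⟩ := hcomm.exists_pow_mul_eq hcop
    exact hbM (hn ▸ pow_mem hh n)
  have hone : ∀ y, y ∉ regularKernel p A → orderOf y ≠ 1 := by
    rintro y hy hy1
    exact hy (orderOf_eq_one_iff.1 hy1 ▸ one_mem _)
  have hord := hcomm.orderOf_mul_eq_mul_orderOf_of_coprime hcop
  rcases h.isConj_of_notMem_kernel hb hx (h.not_dvd_orderOf_mul hcomm hb hx) hbM hxM hbxM with
    hh | hh | hh
  · rw [hh.orderOf_eq'] at hcop
    exact hone x hxM (by simpa using hcop)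
  · rw [hh.orderOf_eq', hord, mul_comm] at hcop
    exact hone b hbM (by simpa using (Nat.Coprime.coprime_mul_left_right hcop))
  · have := hh.orderOf_eq'.trans hord
    exact hone x hxM (Nat.eq_of_mul_eq_mul_left (orderOf_pos b) (by rw [mul_one, ← this]))

end IsRegularSplitting

namespace IsRegularSplitting

variable {p : ℕ} {G : Type*} [Group G] [Finite G] {H : Subgroup G} {A : Set G} {b₀ : G}

/-- If every `p`-regular element outside of the kernel centralizes a Sylow `p`-subgroup, then the
kernel acts transitively on the Sylow `p`-subgroups. -/
theorem exists_smul_sylow_eq (h : IsRegularSplitting p H A b₀) [Fact p.Prime]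
    (hcs : ∀ x, ¬ p ∣ orderOf x → x ∉ regularKernel p A → ¬ p ∣ classSize x) (P S : Sylow p G) :
    ∃ m ∈ regularKernel p A, m • P = S := by
  have hn := h.kernel_normal
  -- Every `g` is a product of powers of its `p'`-part `y` and its `p`-part `z`. If `y` is outside
  -- the kernel, it centralizes a Sylow subgroup `R` containing `z`, so both normalize `R`;
  -- otherwise only `z` has to. Hence `g` is conjugate into the join.
  have htop : regularKernel p A ⊔ MulAction.stabilizer G P = ⊤ := by
    refine Subgroup.eq_top_of_forall_exists_conj_mem fun g => ?_
    set N := orderOf g with hN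
    set y := g ^ p ^ N.factorization p with hy
    set z := g ^ (N / p ^ N.factorization p) with hz
    have hN0 : N ≠ 0 := (orderOf_pos g).ne'
    have hyo : orderOf y = N / p ^ N.factorization p := by
      rw [hy, orderOf_pow_of_dvd (pow_ne_zero _ h.prime.ne_zero) (Nat.ordProj_dvd N p)]
    have hyr : ¬ p ∣ orderOf y := by
      rw [hyo]
      exact Nat.not_dvd_ordCompl h.prime hN0
    have hzp : z ^ p ^ N.factorization p = 1 := by
      rw [hz, ← pow_mul, Nat.div_mul_cancel (Nat.ordProj_dvd N p), pow_orderOf_eq_one]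
    have hzg : IsPGroup p (Subgroup.zpowers z) := by
      obtain ⟨j, -, hj⟩ := (Nat.dvd_prime_pow h.prime).1 (orderOf_dvd_of_pow_eq_one hzp)
      exact IsPGroup.of_card (n := j) (by rw [Nat.card_zpowers, hj])
    have hyz : Commute z y := (Commute.refl g).pow_pow _ _
    obtain ⟨α, β, hg⟩ : ∃ α β : ℤ, g = y ^ α * z ^ β := by
      have hcop : Nat.Coprime (p ^ N.factorization p) (N / p ^ N.factorization p) :=
        (Nat.coprime_ordCompl h.prime hN0).pow_left _
      refine ⟨(p ^ N.factorization p).gcdA (N / p ^ N.factorization p),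
        (p ^ N.factorization p).gcdB (N / p ^ N.factorization p), ?_⟩
      rw [hy, hz, ← zpow_natCast, ← zpow_natCast, ← zpow_mul, ← zpow_mul, ← zpow_add,
        ← Nat.gcd_eq_gcd_ab, hcop.gcd_eq_one, Nat.cast_one, zpow_one]
    obtain ⟨R, hzR, hyR⟩ : ∃ R : Sylow p G, z ∈ R ∧ (y ∈ regularKernel p A ∨ y • R = R) := by
      by_cases hyM : y ∈ regularKernel p A
      · obtain ⟨R, hR⟩ := hzg.exists_le_sylow
        exact ⟨R, hR (Subgroup.mem_zpowers z), Or.inl hyM⟩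
      · obtain ⟨R, hR, hRC⟩ := hzg.exists_sylow_le_of_not_dvd_index
          (C := Subgroup.centralizer {y}) (by
            rw [Subgroup.zpowers_le]
            exact Subgroup.mem_centralizer_singleton_iff.2 hyz) (hcs y hyr hyM)
        refine ⟨R, hR (Subgroup.mem_zpowers z), Or.inr ?_⟩
        rw [Sylow.smul_eq_iff_mem_normalizer]
        change y ∈ Subgroup.normalizer ((R : Subgroup G) : Set G)
        rw [Subgroup.mem_normalizer_iff]
        have key : ∀ r ∈ R, y * r * y⁻¹ = r := fun r hr => by
          rw [← Subgroup.mem_centralizer_singleton_iff.1 (hRC hr), mul_inv_cancel_right]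
        refine fun r => ⟨fun hr => by rw [key r hr]; exact hr, fun hr => ?_⟩
        have := key _ hr
        rw [show r = y⁻¹ * (y * r * y⁻¹) * y by group]
        nth_rw 1 [← this]
        rwa [show y⁻¹ * (y * (y * r * y⁻¹) * y⁻¹) * y = y * r * y⁻¹ by group]
    have hzR' : z • R = R := by
      rw [Sylow.smul_eq_iff_mem_normalizer]
      exact Subgroup.le_normalizer hzR
    obtain ⟨k, rfl⟩ := MulAction.exists_smul_eq G P R
    have hstab : ∀ w : G, w • k • P = k • P → k⁻¹ * w * k ∈ MulAction.stabilizer G P := by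
      intro w hw
      rw [MulAction.mem_stabilizer_iff, mul_smul, mul_smul, hw, inv_smul_smul]
    refine ⟨k, ?_⟩
    have hz' : k⁻¹ * z * k ∈ regularKernel p A ⊔ MulAction.stabilizer G P :=
      Subgroup.mem_sup_right (hstab z hzR')
    have hy' : k⁻¹ * y * k ∈ regularKernel p A ⊔ MulAction.stabilizer G P := by
      rcases hyR with hyR | hyR
      · exact Subgroup.mem_sup_left (by simpa using hn.conj_mem y hyR k⁻¹)
      · exact Subgroup.mem_sup_right (hstab y hyR)
    have hfin := mul_mem (zpow_mem hy' α) (zpow_mem hz' β)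
    have hconj : ∀ (w : G) (n : ℤ), (k⁻¹ * w * k) ^ n = k⁻¹ * w ^ n * k := fun w n => by
      simpa using conj_zpow (a := k⁻¹) (b := w) (i := n)
    rw [hconj, hconj, show k⁻¹ * y ^ α * k * (k⁻¹ * z ^ β * k) = k⁻¹ * (y ^ α * z ^ β) * k by group,
      ← hg] at hfin
    exact hfin
  obtain ⟨g, rfl⟩ := MulAction.exists_smul_eq G P S
  obtain ⟨m, hm, n, hn', rfl⟩ := Subgroup.mem_sup_of_normal_left.1 (htop ▸ Subgroup.mem_top g)
  exact ⟨m, hm, by rw [mul_smul, MulAction.mem_stabilizer_iff.1 hn']⟩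

/-- Every class in `A` has size divisible by some prime different from `p`. -/
theorem exists_prime_ne_dvd_classSize (h : IsRegularSplitting p H A b₀) {a : G} (ha : a ∈ A) :
    ∃ s : ℕ, s.Prime ∧ s ≠ p ∧ s ∣ classSize a := by
  by_contra! hcon
  have : Fact p.Prime := ⟨h.prime⟩
  have hn := h.kernel_normal
  obtain ⟨q, n, k, hq, hqp, haA, hk⟩ := h.exists_pow_mem ha
  replace hcon : ∀ s : ℕ, s.Prime → s ∣ classSize (a ^ n) → s = p := by
    intro s hs hd
    by_contra hsp
    exact hcon s hs hsp (hd.trans (classSize_pow_dvd a n))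
  clear ha
  generalize a ^ n = a at haA hk hcon
  have hpa : p ∣ classSize a := by
    obtain ⟨s, hs, hsa⟩ := Nat.exists_prime_and_dvd (classSize_ne_one (h.noncentral a haA))
    exact hcon s hs hsa ▸ hsa
  have hcs : ∀ x, ¬ p ∣ orderOf x → x ∉ regularKernel p A → ¬ p ∣ classSize x :=
    fun x hx hxM => h.not_dvd_classSize_of_notMem_kernel haA h.prime hpa hx hxM
  -- The class size of `a` is now a power of `p`, so for `t ≠ q` its centralizer would contain a
  -- `t`-element outside the kernel.
  have hindex : ∀ t : ℕ, t.Prime → t ≠ p → t ∣ (regularKernel p A).index → t = q := by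
    intro t ht htp hd
    by_contra htq
    obtain ⟨b, hb, hbM, i, hi⟩ := exists_mem_notMem_kernel ht hd (C := Subgroup.centralizer {a})
      (fun hta => htp (hcon t ht hta))
    refine h.not_commute_of_coprime haA (h.regular_of_orderOf_eq ht htp hi) hbM ?_
      (Subgroup.mem_centralizer_singleton_iff.1 hb)
    rw [hi, hk]
    exact Nat.Coprime.pow _ _ ((Nat.coprime_primes ht hq).2 htq)
  have hqM : q ∣ (regularKernel p A).index := by
    obtain ⟨x, hx, hxM⟩ := h.exists_regular_notMem_kernel
    by_contra hqM
    refine hxM (h.mem_kernel_of_coprime (Nat.Coprime.symm (Nat.coprime_of_dvd fun t ht h1 h2 => ?_)))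
    by_cases htp : t = p
    · exact hx (htp ▸ h2)
    · exact hqM (hindex t ht htp h1 ▸ h1)
  obtain ⟨b, -, hbM, i, hi⟩ := exists_mem_notMem_kernel hq hqM (C := ⊤)
    (by rw [Subgroup.index_top]; exact hq.one_lt.ne' ∘ Nat.dvd_one.1)
  have hb := h.regular_of_orderOf_eq hq hqp hi
  obtain ⟨P, hP⟩ := exists_sylow_le_of_not_dvd_index (hcs b hb hbM)
  let _ : CommGroup (regularKernel p A) :=
    { (inferInstance : Group (regularKernel p A)) with
      mul_comm := h.kernel_isMulCommutative.is_comm.comm }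
  -- Once `a ∈ W` is known, `P` centralizes `a`, contradicting `p ∣ classSize a`.
  let W : Subgroup (regularKernel p A) := (Subgroup.centralizer (P : Set G)).subgroupOf _
  have hbP : b⁻¹ ∈ Subgroup.centralizer (P : Set G) := by
    refine inv_mem (Subgroup.mem_centralizer_iff.2 fun x hx => ?_)
    exact Subgroup.mem_centralizer_singleton_iff.1 (hP hx)
  have hmemW : ∀ v : regularKernel p A, v ∈ W ↔ (v : G) ∈ Subgroup.centralizer (P : Set G) :=
    fun v => Subgroup.mem_subgroupOf
  have key : (⟨a, mem_kernel haA⟩ : regularKernel p A) ∈ W := by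
    refine mem_of_forall_exists_commutator_mul hq (β := MulAut.conjNormal b⁻¹) (i := i) (k := k)
      ?_ ?_ ?_ ?_
    · rw [← map_pow, inv_pow, ← hi, pow_orderOf_eq_one, inv_one, map_one]
    · refine le_antisymm ?_ fun w hw => ?_
      · rintro _ ⟨w, hw, rfl⟩
        rw [hmemW]
        have hw' := (hmemW w).1 hw
        simpa using mul_mem (mul_mem hbP hw') (inv_mem hbP)
      · refine ⟨MulAut.conjNormal b w, ?_, ?_⟩
        · change _ ∈ W
          rw [hmemW, MulAut.conjNormal_apply]
          have hw' := (hmemW w).1 hw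
          simpa using mul_mem (mul_mem (inv_mem hbP) hw') hbP
        · apply Subtype.ext
          simp
    -- `b * u` is again `p`-regular outside the kernel, so it centralizes a Sylow subgroup `m • P`
    -- with `m` in the kernel. Then `m⁻¹ * (b * u) * m` centralizes `P`, which writes `u` as a
    -- commutator of `b⁻¹` and `m` times an element of `W`.
    · intro u
      have hbu : b * u ∉ regularKernel p A := fun hh =>
        hbM ((Subgroup.mul_mem_cancel_right _ u.2).1 hh)
      obtain ⟨S, hS⟩ := exists_sylow_le_of_not_dvd_index
        (hcs _ (h.regular_mul_kernel hb u.2) hbu)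
      obtain ⟨m, hm, rfl⟩ := h.exists_smul_sylow_eq hcs P S
      have hc : m⁻¹ * (b * u) * m ∈ Subgroup.centralizer (P : Set G) := by
        refine Subgroup.mem_centralizer_iff.2 fun x hx => ?_
        have hx' : m * x * m⁻¹ ∈ ((m • P : Sylow p G) : Subgroup G) := by
          rw [Sylow.coe_subgroup_smul]
          exact ⟨x, hx, rfl⟩
        have := Subgroup.mem_centralizer_singleton_iff.1 (hS hx')
        calc x * (m⁻¹ * (b * u) * m) = m⁻¹ * (m * x * m⁻¹ * (b * u)) * m := by group
          _ = _ := by rw [this]; group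
      refine ⟨⟨m, hm⟩, ⟨b⁻¹ * (m⁻¹ * (b * u) * m), ?_⟩, ?_, ?_⟩
      · have h1 := hn.conj_mem _ (inv_mem hm) b⁻¹
        have := mul_mem (mul_mem h1 u.2) hm
        rw [inv_inv] at this
        rwa [show b⁻¹ * (m⁻¹ * (b * u) * m) = b⁻¹ * m⁻¹ * b * u * m by group]
      · rw [hmemW]
        exact mul_mem hbP hc
      · apply Subtype.ext
        rw [Subgroup.coe_mul, Subgroup.coe_mul, MulAut.conjNormal_apply]
        have h1 : Commute (m⁻¹ : G) (b⁻¹ * m⁻¹ * b) :=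
          h.commute_of_mem_kernel (inv_mem hm) (by simpa using hn.conj_mem _ (inv_mem hm) b⁻¹)
        have h2 : Commute (u : G) m := h.commute_of_mem_kernel u.2 hm
        change (u : G) = b⁻¹ * m * b⁻¹⁻¹ * m⁻¹ * (b⁻¹ * (m⁻¹ * (b * u) * m))
        calc (u : G) = b⁻¹ * m * b * (b⁻¹ * m⁻¹ * b * m⁻¹) * (m * u) := by group
          _ = b⁻¹ * m * b * (m⁻¹ * (b⁻¹ * m⁻¹ * b)) * (u * m) := by rw [h1.eq, h2.eq]
          _ = _ := by group
    · apply Subtype.ext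
      rw [Subgroup.coe_pow, ← hk]
      exact pow_orderOf_eq_one a
  have hle : (P : Subgroup G) ≤ Subgroup.centralizer {a} := fun x hx =>
    Subgroup.mem_centralizer_singleton_iff.2
      (Subgroup.mem_centralizer_iff.1 ((hmemW _).1 key) x hx)
  exact P.not_dvd_index (hpa.trans (Subgroup.index_dvd_of_le hle))

/-- There is a prime `r ≠ p` dividing the sizes of all classes in `A` such that the index of the
kernel has at most the prime divisors `p` and `r`. -/
theorem exists_prime (h : IsRegularSplitting p H A b₀) :
    ∃ r : ℕ, r.Prime ∧ r ≠ p ∧ (∀ a ∈ A, r ∣ classSize a) ∧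
      ∀ t : ℕ, t.Prime → t ∣ (regularKernel p A).index → t = p ∨ t = r := by
  obtain ⟨a₀, ha₀⟩ := h.nonempty
  obtain ⟨r, hr, hrp, hra⟩ := h.exists_prime_ne_dvd_classSize ha₀
  have hindex : ∀ t : ℕ, t.Prime → t ∣ (regularKernel p A).index → t = p ∨ t = r := by
    intro t ht hd
    by_cases htp : t = p
    · exact Or.inl htp
    · exact Or.inr (h.eq_of_dvd_index_kernel ha₀ hr hrp hra ht htp hd)
  refine ⟨r, hr, hrp, fun a ha => ?_, hindex⟩
  obtain ⟨s, hs, hsp, hsa⟩ := h.exists_prime_ne_dvd_classSize ha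
  rcases hindex s hs (hsa.trans (h.classSize_dvd_index_kernel (mem_kernel ha))) with rfl | rfl
  · exact absurd rfl hsp
  · exact hsa

/-! ### Fixed point free action on the kernel modulo the center -/

section Prime

variable {r : ℕ}

/-- The non-central elements of the kernel belong to `A`. -/
theorem mem_of_mem_kernel (h : IsRegularSplitting p H A b₀) (hr : r.Prime)
    (hA : ∀ a ∈ A, r ∣ classSize a)
    (hindex : ∀ t : ℕ, t.Prime → t ∣ (regularKernel p A).index → t = p ∨ t = r) {x : G}
    (hx : x ∈ regularKernel p A) (hxc : x ∉ Subgroup.center G) : x ∈ A := by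
  by_contra hxA
  obtain ⟨t, n, j, ht, htx, hyc, hj⟩ := exists_pow_notMem_of_primePow hxc
  have hyA : x ^ n ∉ A := fun hy =>
    hxA (h.mem_of_dvd' hy (h.regular_of_mem_kernel hx) hxc (classSize_pow_dvd x n))
  have hyM : x ^ n ∈ regularKernel p A := pow_mem hx n
  generalize x ^ n = y at hyc hj hyA hyM
  have hy := h.regular_of_mem_kernel hyM
  obtain ⟨a₀, ha₀⟩ := h.nonempty
  obtain ⟨q, l, k, hq, hqp, ha, hk⟩ := h.exists_pow_mem ha₀
  generalize a₀ ^ l = a at ha hk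
  have hcop := h.coprime a ha y hy hyc hyA
  -- Only `p` and `r` divide the index of the kernel, and `r` already divides `classSize a`.
  have hpy : ∀ s : ℕ, s.Prime → s ∣ classSize y → s = p := by
    intro s hs hsy
    refine (hindex s hs (hsy.trans (h.classSize_dvd_index_kernel hyM))).resolve_right ?_
    rintro rfl
    exact Nat.not_coprime_of_dvd_of_dvd hr.one_lt (hA a ha) hsy hcop
  have hpdvd : p ∣ classSize y := by
    obtain ⟨s, hs, hsy⟩ := Nat.exists_prime_and_dvd (classSize_ne_one hyc)
    exact hpy s hs hsy ▸ hsy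
  -- If `y * a ∈ A`, the roles are exchanged: the class of `a` is stable under quotients of
  -- conjugates of `y`, so `t` divides its size. Otherwise `q` divides the size of the class of `y`,
  -- a power of `p`.
  by_cases hya : y * a ∈ A
  · have hay : a * y = y * a := h.commute_of_mem_kernel (mem_kernel ha) hyM
    have hle : classSize (a * y) ≤ classSize a := by
      refine Nat.le_of_dvd (classSize_pos a) ?_
      have h1 := h.coprime _ hya y hy hyc hyA
      rw [← hay] at h1
      exact h1.dvd_of_dvd_mul_right (classSize_mul_dvd_of_coprime hcop)
    obtain ⟨b, hb, htb⟩ := h.exists_isConj_dvd_orderOf hyM hyc ht hj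
    have hta : t ∣ classSize a :=
      htb.trans (orderOf_dvd_classSize (mul_inv_mem_classStabilizer hcop hle hb))
    rcases hindex t ht (hta.trans (h.classSize_dvd_index_kernel (mem_kernel ha))) with rfl | rfl
    · exact Nat.not_coprime_of_dvd_of_dvd ht.one_lt hta hpdvd hcop
    · have htq : t ≠ q := by
        rintro rfl
        exact h.not_dvd_classSize_of_orderOf ha ht hk hta
      have hco : (orderOf y).Coprime (orderOf a) := by
        rw [hj, hk]
        exact Nat.Coprime.pow _ _ ((Nat.coprime_primes ht hq).2 htq)
      have hd := ((show Commute y a from hay.symm).classSize_dvd_mul hco).1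
      exact Nat.not_coprime_of_dvd_of_dvd h.prime.one_lt (hpdvd.trans hd) hpdvd
        (h.coprime _ hya y hy hyc hyA)
  · obtain ⟨b, hb, hqb⟩ := h.exists_isConj_dvd_orderOf (mem_kernel ha) (h.noncentral a ha) hq hk
    exact hqp (hpy q hq (hqb.trans (orderOf_dvd_classSize (mul_inv_mem_classStabilizer hcop.symm
      (h.classSize_mul_le ha hy hyc hyA hya) hb))))

/-- A `p`-regular element outside of the kernel has an `r`-element outside of the kernel among its
powers. -/
theorem exists_pow_notMem_kernel (h : IsRegularSplitting p H A b₀)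
    (hindex : ∀ t : ℕ, t.Prime → t ∣ (regularKernel p A).index → t = p ∨ t = r) {x : G}
    (hx : ¬ p ∣ orderOf x) (hxM : x ∉ regularKernel p A) :
    ∃ n i : ℕ, x ^ n ∉ regularKernel p A ∧ orderOf (x ^ n) = r ^ i := by
  obtain ⟨s, n, i, hs, hsx, hn, hi⟩ := exists_pow_notMem_of_primePow hxM
  refine ⟨n, i, hn, ?_⟩
  have hsM : s ∣ (regularKernel p A).index := by
    by_contra hsM
    refine hn (h.mem_kernel_of_coprime ?_)
    rw [hi]
    exact ((Nat.Prime.coprime_iff_not_dvd hs).2 hsM).pow_left _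
  rcases hindex s hs hsM with rfl | rfl
  · exact absurd hsx hx
  · exact hi

/-- A non-central element of the kernel has a non-central power of prime power order, for a prime
different from `r`. -/
theorem exists_pow_notMem_center (h : IsRegularSplitting p H A b₀) (hr : r.Prime)
    (hA : ∀ a ∈ A, r ∣ classSize a)
    (hindex : ∀ t : ℕ, t.Prime → t ∣ (regularKernel p A).index → t = p ∨ t = r) {m : G}
    (hm : m ∈ regularKernel p A) (hmc : m ∉ Subgroup.center G) :
    ∃ q n k : ℕ, q.Prime ∧ q ≠ r ∧ m ^ n ∈ A ∧ orderOf (m ^ n) = q ^ k := by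
  obtain ⟨q, n, k, hq, -, hn, hk⟩ := exists_pow_notMem_of_primePow hmc
  have hmA := h.mem_of_mem_kernel hr hA hindex (pow_mem hm n) hn
  refine ⟨q, n, k, hq, ?_, hmA, hk⟩
  rintro rfl
  exact h.not_dvd_classSize_of_orderOf hmA hq hk (hA _ hmA)

/-- The action of the `p`-regular elements outside of the kernel on the kernel modulo the center
is fixed point free. -/
theorem mem_center_of_commutator_mem_center (h : IsRegularSplitting p H A b₀) (hr : r.Prime)
    (hrp : r ≠ p) (hA : ∀ a ∈ A, r ∣ classSize a)
    (hindex : ∀ t : ℕ, t.Prime → t ∣ (regularKernel p A).index → t = p ∨ t = r) {x m : G}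
    (hx : ¬ p ∣ orderOf x) (hxM : x ∉ regularKernel p A) (hm : m ∈ regularKernel p A)
    (hxm : x * m * x⁻¹ * m⁻¹ ∈ Subgroup.center G) : m ∈ Subgroup.center G := by
  by_contra hmc
  obtain ⟨n, i, hn, hi⟩ := h.exists_pow_notMem_kernel hindex hx hxM
  obtain ⟨q, l, k, hq, hqr, hlA, hk⟩ := h.exists_pow_notMem_center hr hA hindex hm hmc
  -- A central commutator is multiplicative in each argument. Passing to powers of orders `r ^ i`
  -- and `q ^ k` therefore makes it trivial, against `not_commute_of_coprime`.
  have hpow : ∀ {x m : G} (j : ℕ), x * m * x⁻¹ * m⁻¹ ∈ Subgroup.center G →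
      x * m ^ j * x⁻¹ * (m ^ j)⁻¹ = (x * m * x⁻¹ * m⁻¹) ^ j := by
    intro x m j hz
    have h1 : (x * m * x⁻¹) ^ j = ((x * m * x⁻¹ * m⁻¹) * m) ^ j := by group
    rw [conj_pow, (show Commute (x * m * x⁻¹ * m⁻¹) m from
      (Subgroup.mem_center_iff.1 hz m).symm).mul_pow] at h1
    rw [h1, mul_inv_cancel_right]
  have hpow' : ∀ {x m : G} (j : ℕ), x * m * x⁻¹ * m⁻¹ ∈ Subgroup.center G →
      x ^ j * m * (x ^ j)⁻¹ * m⁻¹ = (x * m * x⁻¹ * m⁻¹) ^ j := by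
    intro x m j hz
    have hz' := inv_mem hz
    have heq : (x * m * x⁻¹ * m⁻¹)⁻¹ = m * x * m⁻¹ * x⁻¹ := by group
    rw [heq] at hz'
    have h1 := hpow j hz'
    rw [← heq, inv_pow, eq_inv_iff_mul_eq_one, mul_eq_one_iff_inv_eq] at h1
    rw [← h1]
    group
  have hz1 : x * m ^ l * x⁻¹ * (m ^ l)⁻¹ ∈ Subgroup.center G := by
    rw [hpow l hxm]; exact pow_mem hxm l
  have hz2 : x ^ n * m ^ l * (x ^ n)⁻¹ * (m ^ l)⁻¹ ∈ Subgroup.center G := by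
    rw [hpow' n hz1]; exact pow_mem hz1 n
  have hy := h.regular_of_orderOf_eq hr hrp hi
  generalize x ^ n = y at hn hi hz2 hy
  generalize m ^ l = a at hlA hk hz2
  have hcop : (r ^ i).Coprime (q ^ k) :=
    Nat.Coprime.pow _ _ ((Nat.coprime_primes hr hq).2 hqr.symm)
  have h1 : (y * a * y⁻¹ * a⁻¹) ^ r ^ i = 1 := by
    rw [← hpow' _ hz2, ← hi, pow_orderOf_eq_one]; group
  have h2 : (y * a * y⁻¹ * a⁻¹) ^ q ^ k = 1 := by
    rw [← hpow _ hz2, ← hk, pow_orderOf_eq_one]; group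
  have h3 : y * a * y⁻¹ * a⁻¹ = 1 := by
    rw [← orderOf_eq_one_iff]
    exact Nat.eq_one_of_dvd_coprimes hcop (orderOf_dvd_of_pow_eq_one h1)
      (orderOf_dvd_of_pow_eq_one h2)
  refine h.not_commute_of_coprime hlA hy hn (by rwa [hi, hk]) ?_
  rwa [mul_inv_eq_one, mul_inv_eq_iff_eq_mul] at h3

end Prime

end IsRegularSplitting

/-! ### Cyclicity of the complement modulo the kernel -/

/-- A finite abelian group acting faithfully and fixed point freely on a non-trivial finite abelian
group is cyclic. -/
theorem isCyclic_of_fixedPointFree {A V : Type*} [CommGroup A] [Finite A] [CommGroup V] [Finite V]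
    [Nontrivial V] (φ : A →* MulAut V) (hφ : ∀ a : A, ∀ v : V, φ a v = v → a = 1 ∨ v = 1) :
    IsCyclic A := by
  let ψ : A →* Module.End ℤ (Additive V) :=
    { toFun := fun a => (MonoidHom.toAdditive (φ a).toMonoidHom).toIntLinearMap
      map_one' := by ext v; simp
      map_mul' := fun a b => by ext v; simp }
  let Ψ : MonoidAlgebra ℤ A →+* Module.End ℤ (Additive V) :=
    (MonoidAlgebra.lift ℤ (Module.End ℤ (Additive V)) A ψ).toRingHom
  let _ : Module (MonoidAlgebra ℤ A) (Additive V) := Module.compHom (Additive V) Ψ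
  have hsmul : ∀ (a : A) (v : Additive V),
      MonoidAlgebra.single a (1 : ℤ) • v = Additive.ofMul (φ a v.toMul) := by
    intro a v
    change Ψ (MonoidAlgebra.single a (1 : ℤ)) v = _
    have : Ψ (MonoidAlgebra.single a (1 : ℤ)) = ψ a := by
      change MonoidAlgebra.lift ℤ (Module.End ℤ (Additive V)) A ψ _ = _
      rw [MonoidAlgebra.lift_single, one_smul]
    rw [this]
    rfl
  have hnoeth : IsNoetherianRing (MonoidAlgebra ℤ A) := IsNoetherianRing.of_finite ℤ _
  -- `P` is the prime annihilator of some `v ≠ 0`. If `a` is `1` modulo `P`, it fixes `v`, so the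
  -- group embeds into the units of a domain.
  obtain ⟨P, hP⟩ := associatedPrimes.nonempty (MonoidAlgebra ℤ A) (Additive V)
  obtain ⟨hprime, v, hv⟩ := Submodule.isAssociatedPrime_iff.1 hP
  have hmem : ∀ c : MonoidAlgebra ℤ A, c ∈ P ↔ c • v = 0 := by
    intro c
    rw [hv, Submodule.mem_colon_singleton, Submodule.mem_bot]
  have hv0 : v.toMul ≠ 1 := by
    intro h0
    refine hprime.ne_top ((Ideal.eq_top_iff_one P).2 ((hmem 1).2 ?_))
    rw [one_smul]
    exact h0
  have : IsDomain (MonoidAlgebra ℤ A ⧸ P) := (Ideal.Quotient.isDomain_iff_prime P).2 hprime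
  refine isCyclic_of_injective_ringHom (R := MonoidAlgebra ℤ A ⧸ P)
    ((Ideal.Quotient.mk P).toMonoidHom.comp (MonoidAlgebra.of ℤ A)) ?_
  rw [injective_iff_map_eq_one]
  intro a ha
  have h1 : Ideal.Quotient.mk P (MonoidAlgebra.single a (1 : ℤ)) = Ideal.Quotient.mk P 1 := ha
  rw [Ideal.Quotient.eq, hmem, sub_smul, one_smul, hsmul, sub_eq_zero] at h1
  exact (hφ a v.toMul h1).resolve_right hv0

/-- Let `Q` be a Sylow `r`-subgroup, all of whose elements have classes of size prime to `r`. If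
any two commuting elements of `Q` lie in a cyclic subgroup of `Q`, then `Q` is cyclic. -/
theorem exists_forall_mem_zpowers {Γ : Type*} [Group Γ] [Finite Γ] {r : ℕ} (hr : r.Prime)
    {Q : Subgroup Γ} (hQ : IsPGroup r Q) (hQi : ¬ r ∣ Q.index)
    (hcs : ∀ x ∈ Q, ¬ r ∣ classSize x)
    (hcomm : ∀ x ∈ Q, ∀ y ∈ Q, Commute x y →
      ∃ z ∈ Q, x ∈ Subgroup.zpowers z ∧ y ∈ Subgroup.zpowers z) :
    ∃ x ∈ Q, ∀ y ∈ Q, y ∈ Subgroup.zpowers x := by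
  have : Fact r.Prime := ⟨hr⟩
  -- An element of maximal order is centralized by a conjugate of `Q` containing it, so it has a
  -- conjugate in the center of `Q`. A cyclic subgroup of `Q` containing that conjugate cannot be
  -- larger than the group it generates.
  obtain ⟨x, hx, hmax⟩ := Set.exists_max_image (Q : Set Γ) orderOf (Set.toFinite _) ⟨1, Q.one_mem⟩
  have hxp : IsPGroup r (Subgroup.zpowers x) := hQ.to_le (by rwa [Subgroup.zpowers_le])
  obtain ⟨S, hxS, hS⟩ := hxp.exists_sylow_le_of_not_dvd_index (C := Subgroup.centralizer {x}) (by
    rw [Subgroup.zpowers_le]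
    exact Subgroup.mem_centralizer_singleton_iff.2 rfl) (hcs x hx)
  obtain ⟨g, rfl⟩ := MulAction.exists_smul_eq Γ (hQ.toSylow hQi) S
  have hmem : ∀ y ∈ Q, g * y * g⁻¹ ∈ ((g • hQ.toSylow hQi : Sylow r Γ) : Subgroup Γ) := by
    intro y hy
    rw [Sylow.coe_subgroup_smul]
    exact ⟨y, hy, rfl⟩
  have hx' : g⁻¹ * x * g ∈ Q := by
    have h1 := hxS (Subgroup.mem_zpowers x)
    rw [Sylow.coe_subgroup_smul] at h1
    obtain ⟨y, hy, rfl⟩ := h1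
    have : g⁻¹ * (g * y * g⁻¹) * g ∈ Q := by
      rw [show g⁻¹ * (g * y * g⁻¹) * g = y by group]
      exact hy
    exact this
  have hord : orderOf (g⁻¹ * x * g) = orderOf x := by
    have := (isConj_conj g⁻¹ x).orderOf_eq'
    rw [inv_inv] at this
    exact this.symm
  refine ⟨_, hx', fun y hy => ?_⟩
  have hc : Commute (g⁻¹ * x * g) y := by
    have := Subgroup.mem_centralizer_singleton_iff.1 (hS (hmem y hy))
    calc g⁻¹ * x * g * y = g⁻¹ * (x * (g * y * g⁻¹)) * g := by group
      _ = _ := by rw [← this]; group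
  obtain ⟨z, hz, hxz, hyz⟩ := hcomm _ hx' y hy hc
  have heq : Subgroup.zpowers (g⁻¹ * x * g) = Subgroup.zpowers z := by
    refine Subgroup.eq_of_le_of_card_ge (by rwa [Subgroup.zpowers_le]) ?_
    rw [Nat.card_zpowers, Nat.card_zpowers, hord]
    exact hmax z hz
  rwa [heq]

namespace IsRegularSplitting

variable {p : ℕ} {G : Type*} [Group G] {H : Subgroup G} {A : Set G} {b₀ : G} {r : ℕ}

theorem regular_of_mem (h : IsRegularSplitting p H A b₀) {x : G} (hx : x ∈ H) :
    ¬ p ∣ orderOf x :=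
  fun hd => h.isPComplement.1 (hd.trans (Subgroup.orderOf_dvd_natCard H hx))

variable [Finite G]

/-- Two elements of the complement which commute modulo the kernel generate a cyclic group modulo
the kernel. -/
theorem exists_common_generator (h : IsRegularSplitting p H A b₀) (hr : r.Prime)
    (hrp : r ≠ p) (hA : ∀ a ∈ A, r ∣ classSize a)
    (hindex : ∀ t : ℕ, t.Prime → t ∣ (regularKernel p A).index → t = p ∨ t = r) {x y : G}
    (hx : x ∈ H) (hy : y ∈ H) (hxy : (x * y)⁻¹ * (y * x) ∈ regularKernel p A) :
    ∃ z ∈ H, ∃ i j : ℤ, x * z ^ i ∈ regularKernel p A ∧ y * z ^ j ∈ regularKernel p A := by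
  have hn := h.kernel_normal
  -- `H` acts on `N` by conjugation; elements of the kernel act trivially, all others fixed point
  -- freely.
  let N : Subgroup (G ⧸ Subgroup.center G) :=
    (regularKernel p A).map (QuotientGroup.mk' (Subgroup.center G))
  have hNn : N.Normal := hn.map _ (QuotientGroup.mk'_surjective _)
  have hNc : ∀ u v : N, u * v = v * u := by
    rintro ⟨_, u, hu, rfl⟩ ⟨_, v, hv, rfl⟩
    apply Subtype.ext
    change QuotientGroup.mk' _ u * QuotientGroup.mk' _ v =
      QuotientGroup.mk' _ v * QuotientGroup.mk' (Subgroup.center G) u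
    rw [← map_mul, ← map_mul, (h.commute_of_mem_kernel hu hv).eq]
  let _ : CommGroup N := { (inferInstance : Group N) with mul_comm := hNc }
  let φ : G →* MulAut N := MulAut.conjNormal.comp (QuotientGroup.mk' (Subgroup.center G))
  have hφ : ∀ (g : G) (v : N), ((φ g v : N) : G ⧸ Subgroup.center G) =
      (g : G ⧸ Subgroup.center G) * (v : G ⧸ Subgroup.center G) * (g : G ⧸ Subgroup.center G)⁻¹ :=
    fun g v => MulAut.conjNormal_apply _ _
  have hφ1 : ∀ m ∈ regularKernel p A, φ m = 1 := by
    intro m hm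
    ext v
    have := hNc ⟨_, m, hm, rfl⟩ v
    rw [hφ, mul_inv_eq_iff_eq_mul]
    exact congrArg Subtype.val this
  have hfix : ∀ w ∈ H, w ∉ regularKernel p A → ∀ v : N, φ w v = v → v = 1 := by
    rintro w hw hwM ⟨_, m, hm, rfl⟩ hv
    have h1 := congrArg Subtype.val hv
    rw [hφ, ← mul_inv_eq_one] at h1
    have h2 : w * m * w⁻¹ * m⁻¹ ∈ Subgroup.center G := (QuotientGroup.eq_one_iff _).1 h1
    apply Subtype.ext
    exact (QuotientGroup.eq_one_iff _).2 (h.mem_center_of_commutator_mem_center hr hrp hA hindex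
      (h.regular_of_mem hw) hwM hm h2)
  have hnt : Nontrivial N := by
    obtain ⟨a, ha⟩ := h.nonempty
    refine ⟨⟨_, a, mem_kernel ha, rfl⟩, 1, fun heq => h.noncentral a ha ?_⟩
    exact (QuotientGroup.eq_one_iff _).1 (congrArg Subtype.val heq)
  have hker : ∀ w ∈ H, φ w = 1 → w ∈ regularKernel p A := by
    intro w hw hw1
    by_contra hwM
    obtain ⟨v, hv⟩ := exists_ne (1 : N)
    exact hv (hfix w hw hwM v (by rw [hw1]; rfl))
  have hcomm : φ x * φ y = φ y * φ x := by
    have h1 := hφ1 _ hxy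
    rw [map_mul, map_inv, inv_mul_eq_one, map_mul, map_mul] at h1
    exact h1
  let B : Subgroup (MulAut N) := Subgroup.closure {φ x, φ y}
  have hBc : IsMulCommutative B := by
    refine Subgroup.isMulCommutative_closure ?_
    rintro _ (rfl | rfl) _ (rfl | rfl)
    · rfl
    · exact hcomm
    · exact hcomm.symm
    · rfl
  let _ : CommGroup B := { (inferInstance : Group B) with mul_comm := hBc.is_comm.comm }
  have hBH : B ≤ H.map φ := by
    refine (Subgroup.closure_le _).2 ?_
    rintro _ (rfl | rfl)
    · exact ⟨x, hx, rfl⟩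
    · exact ⟨y, hy, rfl⟩
  have hcyc : IsCyclic B := by
    refine isCyclic_of_fixedPointFree (V := N) B.subtype ?_
    intro β v hv
    obtain ⟨w, hw, hwβ⟩ := hBH β.2
    by_cases hwM : w ∈ regularKernel p A
    · left
      apply Subtype.ext
      rw [← hwβ]
      exact hφ1 w hwM
    · right
      refine hfix w hw hwM v ?_
      rw [hwβ]
      exact hv
  obtain ⟨⟨β, hβ⟩, hgen⟩ := hcyc.exists_generator
  obtain ⟨z, hz, rfl⟩ := hBH hβ
  have hex : ∀ w ∈ H, φ w ∈ B → ∃ i : ℤ, w * z ^ i ∈ regularKernel p A := by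
    intro w hw hwB
    obtain ⟨i, hi⟩ := hgen ⟨φ w, hwB⟩
    have hi' : φ z ^ i = φ w := congrArg Subtype.val hi
    refine ⟨-i, hker _ (H.mul_mem hw (H.zpow_mem hz _)) ?_⟩
    rw [map_mul, map_zpow, zpow_neg, hi', mul_inv_cancel]
  obtain ⟨i, hi⟩ := hex x hx (Subgroup.subset_closure (Or.inl rfl))
  obtain ⟨j, hj⟩ := hex y hy (Subgroup.subset_closure (Or.inr rfl))
  exact ⟨z, hz, i, j, hi, hj⟩

/-- The complement is cyclic modulo the kernel. -/
theorem exists_generator (h : IsRegularSplitting p H A b₀) (hr : r.Prime)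
    (hrp : r ≠ p) (hA : ∀ a ∈ A, r ∣ classSize a)
    (hindex : ∀ t : ℕ, t.Prime → t ∣ (regularKernel p A).index → t = p ∨ t = r) :
    ∃ b ∈ H, ∀ x ∈ H, ∃ n : ℤ, x * b ^ n ∈ regularKernel p A := by
  have hn := h.kernel_normal
  let f := QuotientGroup.mk' (regularKernel p A)
  have hf : Function.Surjective f := QuotientGroup.mk'_surjective _
  -- The order of `H` is prime to `p`, which leaves only `r`. As the index is a power of `p`, the
  -- image of `H` is a Sylow `r`-subgroup.
  have hQ : IsPGroup r (H.map f) := by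
    refine IsPGroup.of_card (Nat.eq_prime_pow_of_unique_prime_dvd Nat.card_pos.ne' ?_)
    intro t ht hd
    refine (hindex t ht (hd.trans (Subgroup.card_subgroup_dvd_card _))).resolve_left ?_
    rintro rfl
    exact h.isPComplement.1 (hd.trans (Subgroup.card_map_dvd _ _))
  have hQi : ¬ r ∣ (H.map f).index := by
    intro hd
    obtain ⟨k, hk⟩ := h.isPComplement.2
    have := hd.trans (Subgroup.index_map_dvd H hf)
    rw [hk] at this
    exact hrp ((Nat.prime_dvd_prime_iff_eq hr h.prime).1 (hr.dvd_of_dvd_pow this))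
  obtain ⟨a, ha⟩ := h.nonempty
  have hcs : ∀ x ∈ H.map f, ¬ r ∣ classSize x := by
    rintro _ ⟨x, hx, rfl⟩
    by_cases hxM : x ∈ regularKernel p A
    · rw [show f x = 1 from (QuotientGroup.eq_one_iff x).2 hxM,
        classSize_eq_one_iff.2 (one_mem _)]
      exact hr.one_lt.ne' ∘ Nat.dvd_one.1
    · intro hd
      refine h.not_dvd_classSize_of_notMem_kernel ha hr (hA a ha) (h.regular_of_mem hx) hxM
        (hd.trans (dvd_trans (Subgroup.index_dvd_of_le ?_)
          (Subgroup.index_map_dvd (Subgroup.centralizer {x}) hf)))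
      rintro _ ⟨y, hy, rfl⟩
      rw [Subgroup.mem_centralizer_singleton_iff, ← map_mul, ← map_mul]
      exact congrArg f (Subgroup.mem_centralizer_singleton_iff.1 hy)
  have hcomm : ∀ x ∈ H.map f, ∀ y ∈ H.map f, Commute x y →
      ∃ z ∈ H.map f, x ∈ Subgroup.zpowers z ∧ y ∈ Subgroup.zpowers z := by
    rintro _ ⟨x, hx, rfl⟩ _ ⟨y, hy, rfl⟩ hxy
    obtain ⟨z, hz, i, j, hi, hj⟩ := h.exists_common_generator hr hrp hA hindex hx hy
      (QuotientGroup.eq.1 (show f (x * y) = f (y * x) by rw [map_mul, map_mul]; exact hxy))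
    have key : ∀ (w : G) (n : ℤ), w * z ^ n ∈ regularKernel p A →
        f w ∈ Subgroup.zpowers (f z) := by
      intro w n hw
      refine ⟨-n, ?_⟩
      have h1 : f (w * z ^ n) = 1 := (QuotientGroup.eq_one_iff _).2 hw
      rw [map_mul, map_zpow, mul_eq_one_iff_eq_inv] at h1
      change f z ^ (-n) = f w
      rw [h1, zpow_neg]
    exact ⟨f z, ⟨z, hz, rfl⟩, key x i hi, key y j hj⟩
  obtain ⟨_, ⟨b, hb, rfl⟩, hgen⟩ := exists_forall_mem_zpowers hr hQ hQi hcs hcomm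
  refine ⟨b, hb, fun x hx => ?_⟩
  obtain ⟨n, hn⟩ := hgen (f x) ⟨x, hx, rfl⟩
  refine ⟨-n, (QuotientGroup.eq_one_iff _).1 ?_⟩
  change f (x * b ^ (-n)) = 1
  have hn' : f b ^ n = f x := hn
  rw [map_mul, map_zpow, zpow_neg, hn', mul_inv_cancel]

end IsRegularSplitting

/-! ### Frobenius groups and uniqueness of the kernel -/

section Frobenius

/-- Write `x = m * k`. The map `u ↦ u * (k * u⁻¹ * k⁻¹)` is injective on `N`, hence onto, so `x` is
conjugate to `k ≠ 1` under `N` and inherits its fixed point freeness. -/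
theorem IsFrobeniusWith.eq_one_of_commute {Y : Type*} [Group Y] [Finite Y] {N K : Subgroup Y}
    (h : IsFrobeniusWith N K) {x n : Y} (hx : x ∉ N) (hn : n ∈ N) (hxn : Commute x n) : n = 1 := by
  have hnorm := h.normal
  obtain ⟨⟨⟨m, hm⟩, ⟨k, hk⟩⟩, rfl : m * k = x⟩ := h.isComplement.2 x
  have hk1 : k ≠ 1 := by
    rintro rfl
    exact hx (by rwa [mul_one])
  let f : N → N := fun u => ⟨u * (k * (u : Y)⁻¹ * k⁻¹),
    N.mul_mem u.2 (hnorm.conj_mem _ (N.inv_mem u.2) k)⟩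
  have hf : Function.Injective f := by
    intro u v huv
    have h1 : (u : Y) * (k * (u : Y)⁻¹ * k⁻¹) = v * (k * (v : Y)⁻¹ * k⁻¹) :=
      congrArg Subtype.val huv
    have h2 : (v : Y)⁻¹ * u = 1 := by
      refine h.fixedPointFree k hk hk1 _ (N.mul_mem (N.inv_mem v.2) u.2) ?_
      calc k * ((v : Y)⁻¹ * u) = (v : Y)⁻¹ * (v * (k * (v : Y)⁻¹ * k⁻¹)) * k * u := by group
        _ = _ := by rw [← h1]; group
    exact Subtype.ext (inv_mul_eq_one.1 h2).symm
  obtain ⟨u, hu⟩ := Finite.surjective_of_injective hf ⟨m, hm⟩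
  have hu' : (u : Y) * (k * (u : Y)⁻¹ * k⁻¹) = m := congrArg Subtype.val hu
  have hmk : m * k = u * k * (u : Y)⁻¹ := by rw [← hu']; group
  have h1 : (u : Y)⁻¹ * n * u = 1 := by
    refine h.fixedPointFree k hk hk1 _ (by simpa using hnorm.conj_mem n hn (u : Y)⁻¹) ?_
    have h2 : u * k * (u : Y)⁻¹ * n = n * (u * k * (u : Y)⁻¹) := by rw [← hmk]; exact hxn
    calc k * ((u : Y)⁻¹ * n * u) = (u : Y)⁻¹ * (u * k * (u : Y)⁻¹ * n) * u := by group
      _ = _ := by rw [h2]; group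
  rw [mul_assoc, inv_mul_eq_one] at h1
  simpa using h1

/-- A finite group which is cyclic over an abelian normal subgroup on which it acts fixed point
freely modulo the center is quasi-Frobenius, and all its kernels and complements are abelian. -/
theorem isQuasiFrobenius_of_fixedPointFree {X : Type*} [Group X] [Finite X] {M : Subgroup X}
    [hM : M.Normal] (hMc : ∀ x ∈ M, ∀ y ∈ M, Commute x y) {m₀ : X} (hm₀ : m₀ ∈ M)
    (hm₀c : m₀ ∉ Subgroup.center X) (hne : ∃ x, x ∉ M) {b : X}
    (hb : ∀ x : X, ∃ n : ℤ, x * b ^ n ∈ M)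
    (hfix : ∀ x, x ∉ M → ∀ m ∈ M, x * m * x⁻¹ * m⁻¹ ∈ Subgroup.center X →
      m ∈ Subgroup.center X) :
    IsQuasiFrobenius X ∧ (∀ M : Subgroup X, IsQuasiFrobeniusKernel M → IsMulCommutative M) ∧
      ∀ L : Subgroup X, IsQuasiFrobeniusComplement L → IsMulCommutative L := by
  have hZM : Subgroup.center X ≤ M := by
    intro z hz
    by_contra hzM
    refine hm₀c (hfix z hzM m₀ hm₀ ?_)
    rw [show z * m₀ = m₀ * z from (Subgroup.mem_center_iff.1 hz m₀).symm, mul_inv_cancel_right,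
      mul_inv_cancel]
    exact one_mem _
  have hbM : b ∉ M := by
    intro hbM
    obtain ⟨x, hx⟩ := hne
    obtain ⟨n, hn⟩ := hb x
    exact hx ((M.mul_mem_cancel_right (M.zpow_mem hbM n)).1 hn)
  let f := QuotientGroup.mk' (Subgroup.center X)
  have hf1 : ∀ x, f x = 1 ↔ x ∈ Subgroup.center X := fun x => QuotientGroup.eq_one_iff x
  have hfM : ∀ x, f x ∈ M.map f ↔ x ∈ M := by
    refine fun x => ⟨?_, fun hx => ⟨x, hx, rfl⟩⟩
    rintro ⟨m, hm, hmx⟩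
    have := hZM (QuotientGroup.eq.1 hmx)
    exact (M.mul_mem_cancel_left (M.inv_mem hm)).1 this
  have hNc : ∀ u ∈ M.map f, ∀ v ∈ M.map f, Commute u v := by
    rintro _ ⟨u, hu, rfl⟩ _ ⟨v, hv, rfl⟩
    exact (hMc u hu v hv).map f
  have hNn : (M.map f).Normal := hM.map f (QuotientGroup.mk'_surjective _)
  have hNfix : ∀ y, y ∉ M.map f → ∀ n ∈ M.map f, Commute y n → n = 1 := by
    rintro y hy _ ⟨m, hm, rfl⟩ hym
    obtain ⟨x, rfl⟩ := QuotientGroup.mk'_surjective _ y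
    refine (hf1 m).2 (hfix x (fun hx => hy ((hfM x).2 hx)) m hm ((hf1 _).1 ?_))
    rw [map_mul, map_mul, map_mul, map_inv, map_inv, mul_inv_eq_one, mul_inv_eq_iff_eq_mul]
    exact hym
  have hbj : ∀ j : ℤ, f b ^ j ∈ M.map f → f b ^ j = 1 := fun j hj =>
    hNfix (f b) (fun hh => hbM ((hfM b).1 hh)) _ hj (Commute.self_zpow (f b) j)
  have hmul : ∀ y, ∃ n ∈ M.map f, ∃ j : ℤ, n * f b ^ j = y := by
    intro y
    obtain ⟨x, rfl⟩ := QuotientGroup.mk'_surjective _ y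
    obtain ⟨n, hn⟩ := hb x
    refine ⟨f (x * b ^ n), ⟨_, hn, rfl⟩, -n, ?_⟩
    rw [map_mul, map_zpow, zpow_neg, mul_inv_cancel_right]
  have hF : IsFrobeniusWith (M.map f) (Subgroup.zpowers (f b)) := by
    refine ⟨hNn, fun hbot => ?_, fun hbot => ?_, ?_, ?_⟩
    · have : f m₀ ∈ M.map f := ⟨m₀, hm₀, rfl⟩
      rw [hbot, Subgroup.mem_bot, hf1] at this
      exact hm₀c this
    · rw [Subgroup.zpowers_eq_bot, hf1] at hbot
      exact hbM (hZM hbot)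
    · refine Subgroup.isComplement'_of_disjoint_and_mul_eq_univ ?_ ?_
      · rw [Subgroup.disjoint_def]
        rintro _ hy ⟨j, rfl⟩
        exact hbj j hy
      · refine Set.eq_univ_of_forall fun y => ?_
        obtain ⟨n, hn, j, rfl⟩ := hmul y
        exact Set.mul_mem_mul hn ⟨j, rfl⟩
    · rintro _ ⟨j, rfl⟩ hj n hn hc
      exact hNfix _ (fun hh => hj (hbj j hh)) n hn hc
  -- If `N` properly contains the image of `M`, it contains `f b`, hence everything, and `K` is
  -- trivial. If some `x` in that image is outside `N`, its commutators with `N` lie in both groups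
  -- and commute with `x`, so they vanish and `N` is trivial.
  have huniq : ∀ N K : Subgroup (X ⧸ Subgroup.center X), IsFrobeniusWith N K → N = M.map f := by
    intro N K hNK
    have hn := hNK.normal
    by_cases hle : M.map f ≤ N
    · refine le_antisymm (fun y hy => ?_) hle
      by_contra hyM
      obtain ⟨n, hn, j, rfl⟩ := hmul y
      have hjN : f b ^ j ∈ N := (N.mul_mem_cancel_left (hle hn)).1 hy
      have hbN : f b ∈ N := by
        by_contra hbN
        have := hNK.eq_one_of_commute hbN hjN (Commute.self_zpow (f b) j)
        rw [this, mul_one] at hyM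
        exact hyM hn
      refine hNK.complement_ne_bot ((Subgroup.eq_bot_iff_forall _).2 fun k hk => ?_)
      obtain ⟨u, hu, i, rfl⟩ := hmul k
      exact Subgroup.disjoint_def.1 hNK.isComplement.disjoint
        (N.mul_mem (hle hu) (N.zpow_mem hbN i)) hk
    · obtain ⟨x, hx, hxN⟩ := SetLike.not_le_iff_exists.1 hle
      refine absurd ((Subgroup.eq_bot_iff_forall _).2 fun n hn' => ?_) hNK.kernel_ne_bot
      have hcN : x * n * x⁻¹ * n⁻¹ ∈ N := N.mul_mem (hn.conj_mem n hn' x) (N.inv_mem hn')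
      have hcM : x * n * x⁻¹ * n⁻¹ ∈ M.map f := by
        have := (M.map f).mul_mem hx (hNn.conj_mem _ ((M.map f).inv_mem hx) n)
        rwa [show x * (n * x⁻¹ * n⁻¹) = x * n * x⁻¹ * n⁻¹ by group] at this
      have h1 := hNK.eq_one_of_commute hxN hcN (hNc x hx _ hcM)
      rw [mul_inv_eq_one, mul_inv_eq_iff_eq_mul] at h1
      exact hNK.eq_one_of_commute hxN hn' h1
  refine ⟨⟨_, _, hF⟩, ?_, ?_⟩
  · rintro _ ⟨N, K, hNK, rfl⟩
    rw [huniq N K hNK]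
    refine ⟨⟨fun u v => Subtype.ext ?_⟩⟩
    exact hMc u ((hfM u).1 u.2) v ((hfM v).1 v.2)
  · rintro _ ⟨N, K, hNK, rfl⟩
    have hN := huniq N K hNK
    -- A complement meets the kernel trivially, so its preimage maps to this cyclic group with
    -- central kernel, which makes it abelian.
    have hcyc : IsCyclic ((X ⧸ Subgroup.center X) ⧸ M.map f) := by
      refine ⟨⟨QuotientGroup.mk' _ (f b), fun q => ?_⟩⟩
      obtain ⟨y, rfl⟩ := QuotientGroup.mk'_surjective _ q
      obtain ⟨n, hn, j, rfl⟩ := hmul y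
      refine ⟨j, ?_⟩
      have h1 : QuotientGroup.mk' (M.map f) n = 1 := (QuotientGroup.eq_one_iff n).2 hn
      change QuotientGroup.mk' (M.map f) (f b) ^ j = _
      rw [map_mul, h1, one_mul, map_zpow]
    refine MonoidHom.isMulCommutative_of_isCyclic_of_ker_le_center (((QuotientGroup.mk' (M.map f)).comp f).comp
      (K.comap (QuotientGroup.mk' (Subgroup.center X))).subtype) ?_
    rintro ⟨l, hl⟩ hlk
    have h1 : f l ∈ M.map f := (QuotientGroup.eq_one_iff (f l)).1 hlk
    rw [← hN] at h1
    have h2 := (hf1 l).1 (Subgroup.disjoint_def.1 hNK.isComplement.disjoint h1 hl)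
    exact Subgroup.mem_center_iff.2 fun g => Subtype.ext (Subgroup.mem_center_iff.1 h2 g)

end Frobenius

/-! ### The center of the complement and its structure -/

theorem IsRegularSplitting.map_center {p : ℕ} {G : Type*} [Group G] [Finite G] {H : Subgroup G}
    {A : Set G} {b₀ : G} {r : ℕ} (h : IsRegularSplitting p H A b₀) (hr : r.Prime)
    (hrp : r ≠ p) (hA : ∀ a ∈ A, r ∣ classSize a)
    (hindex : ∀ t : ℕ, t.Prime → t ∣ (regularKernel p A).index → t = p ∨ t = r)
    {x : G} (hxH : x ∈ H) (hxM : x ∉ regularKernel p A) :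
    (Subgroup.center H).map H.subtype = H ⊓ Subgroup.center G := by
  have hfix : ∀ x ∈ H, x ∉ regularKernel p A → ∀ m ∈ regularKernel p A, Commute x m →
      m ∈ Subgroup.center G := by
    intro x hx hxM m hm hxm
    refine h.mem_center_of_commutator_mem_center hr hrp hA hindex (h.regular_of_mem hx) hxM hm ?_
    rw [hxm.eq, mul_inv_cancel_right, mul_inv_cancel]
    exact one_mem _
  refine le_antisymm ?_ ?_
  · rintro _ ⟨z, hz, rfl⟩
    have hcomm : ∀ y ∈ H, Commute y (z : G) := fun y hy =>
      congrArg Subtype.val (Subgroup.mem_center_iff.1 hz ⟨y, hy⟩)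
    refine ⟨z.2, ?_⟩
    -- Inside the kernel, `z` is fixed by `x`. Outside it, `z` would commute with some `a ∈ A`, as
    -- `A` lies in `H`, forcing `a` to be central.
    by_cases hzM : (z : G) ∈ regularKernel p A
    · exact hfix x hxH hxM z hzM (hcomm x hxH)
    · obtain ⟨a, ha⟩ := h.nonempty
      exact absurd (hfix z z.2 hzM a (mem_kernel ha) (hcomm a (h.kernel_le (mem_kernel ha))).symm)
        (h.noncentral a ha)
  · rintro z ⟨hzH, hzc⟩
    exact ⟨⟨z, hzH⟩, Subgroup.mem_center_iff.2 fun g =>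
      Subtype.ext (Subgroup.mem_center_iff.1 hzc g), rfl⟩

/-- The structure of the complement in the presence of a splitting of the `p`-regular classes. -/
theorem IsRegularSplitting.isQuasiFrobenius {p : ℕ} {G : Type*} [Group G] [Finite G] {H : Subgroup G}
    {A : Set G} {b₀ : G} (h : IsRegularSplitting p H A b₀) :
    IsQuasiFrobenius H ∧
      (∀ M : Subgroup H, IsQuasiFrobeniusKernel M → IsMulCommutative M) ∧
      (∀ L : Subgroup H, IsQuasiFrobeniusComplement L → IsMulCommutative L) ∧
      (Subgroup.center H).map H.subtype = H ⊓ Subgroup.center G := by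
  obtain ⟨r, hr, hrp, hA, hindex⟩ := h.exists_prime
  obtain ⟨x, hx, hxM⟩ := h.exists_regular_notMem_kernel
  have hn := h.kernel_normal
  obtain ⟨g, hg⟩ := h.conj_mem x hx
  replace hxM : g * x * g⁻¹ ∉ regularKernel p A := fun hh => hxM (by
    have := hn.conj_mem _ hh g⁻¹
    rwa [show g⁻¹ * (g * x * g⁻¹) * g⁻¹⁻¹ = x by group] at this)
  have hcenter := h.map_center hr hrp hA hindex hg hxM
  have hmemc : ∀ z : H, z ∈ Subgroup.center H ↔ (z : G) ∈ Subgroup.center G := by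
    intro z
    have h1 : (z : G) ∈ (Subgroup.center H).map H.subtype ↔ (z : G) ∈ H ⊓ Subgroup.center G := by
      rw [hcenter]
    rw [Subgroup.mem_inf] at h1
    constructor
    · exact fun hz => (h1.1 ⟨z, hz, rfl⟩).2
    · intro hz
      obtain ⟨w, hw, hwz⟩ := h1.2 ⟨z.2, hz⟩
      rwa [← Subtype.ext hwz]
  obtain ⟨b, hb, hgen⟩ := h.exists_generator hr hrp hA hindex
  obtain ⟨a, ha⟩ := h.nonempty
  have key := isQuasiFrobenius_of_fixedPointFree (X := H) (M := (regularKernel p A).subgroupOf H)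
    (fun x hx y hy => Subtype.ext (h.commute_of_mem_kernel hx hy))
    (m₀ := ⟨a, h.kernel_le (mem_kernel ha)⟩) (mem_kernel ha)
    (fun hc => h.noncentral a ha ((hmemc _).1 hc)) ⟨⟨_, hg⟩, hxM⟩ (b := ⟨b, hb⟩)
    (fun x => hgen x x.2) (fun x hx m hm hc => (hmemc m).2
      (h.mem_center_of_commutator_mem_center hr hrp hA hindex (h.regular_of_mem x.2) hx hm
        ((hmemc _).1 hc)))
  exact ⟨key.1, key.2.1, key.2.2, hcenter⟩

/-! ### From the graph to a splitting -/

section Graph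

variable {p : ℕ} {G : Type*} [Group G]

/-- The vertex of `Γ_p(G)` belonging to a non-central `p`-regular element. -/
def pRegularVertex {x : G} (hx : ¬ p ∣ orderOf x) (hxc : x ∉ Subgroup.center G) :
    PRegularClass p G :=
  ⟨ConjClasses.mk x, by
    obtain ⟨g, hg⟩ : ∃ g, g * x ≠ x * g := by
      by_contra! hc
      exact hxc (Subgroup.mem_center_iff.2 hc)
    refine ⟨x, ConjClasses.mem_carrier_mk, g * x * g⁻¹, ?_, fun h => hg ?_⟩
    · rw [ConjClasses.mem_carrier_iff_mk_eq, ConjClasses.mk_eq_mk_iff_isConj]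
      exact (isConj_conj g x).symm
    · rw [eq_mul_inv_iff_mul_eq] at h
      exact h.symm, fun g hg => by
    rw [ConjClasses.mem_carrier_iff_mk_eq, ConjClasses.mk_eq_mk_iff_isConj] at hg
    rwa [hg.orderOf_eq']⟩

theorem exists_eq_pRegularVertex (C : PRegularClass p G) :
    ∃ (x : G) (hx : ¬ p ∣ orderOf x) (hxc : x ∉ Subgroup.center G), C = pRegularVertex hx hxc := by
  obtain ⟨C, hC, hreg⟩ := C
  obtain ⟨x, rfl⟩ := ConjClasses.exists_rep C
  refine ⟨x, hreg x ConjClasses.mem_carrier_mk, fun hc => ?_, rfl⟩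
  obtain ⟨y, hy, hyx⟩ := Set.Nontrivial.exists_ne hC x
  rw [ConjClasses.mem_carrier_iff_mk_eq, ConjClasses.mk_eq_mk_iff_isConj] at hy
  obtain ⟨g, rfl⟩ := isConj_iff.1 hy.symm
  exact hyx (by rw [Subgroup.mem_center_iff.1 hc g, mul_inv_cancel_right])

theorem card_pRegularVertex {x : G} (hx : ¬ p ∣ orderOf x) (hxc : x ∉ Subgroup.center G) :
    Nat.card (pRegularVertex hx hxc).1.carrier = classSize x := by
  rw [Nat.card_coe_set_eq, classSize_eq_ncard_carrier]
  rfl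

theorem pRegularVertex_eq_iff {x y : G} (hx : ¬ p ∣ orderOf x) (hxc : x ∉ Subgroup.center G)
    (hy : ¬ p ∣ orderOf y) (hyc : y ∉ Subgroup.center G) :
    pRegularVertex hx hxc = pRegularVertex hy hyc ↔ IsConj x y := by
  rw [← ConjClasses.mk_eq_mk_iff_isConj]
  exact Subtype.ext_iff

theorem pRegularGraph_adj_iff {x y : G} (hx : ¬ p ∣ orderOf x) (hxc : x ∉ Subgroup.center G)
    (hy : ¬ p ∣ orderOf y) (hyc : y ∉ Subgroup.center G) :
    (pRegularGraph p G).Adj (pRegularVertex hx hxc) (pRegularVertex hy hyc) ↔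
      ¬ IsConj x y ∧ ¬ (classSize x).Coprime (classSize y) := by
  rw [← pRegularVertex_eq_iff hx hxc hy hyc, ← card_pRegularVertex hx hxc,
    ← card_pRegularVertex hy hyc]
  rfl

theorem exists_isRegularSplitting [Finite G] (hp : p.Prime) (hG : IsPSeparable p G)
    {H : Subgroup G} (hH : IsPComplement p H) (hdisc : ¬ (pRegularGraph p G).Preconnected)
    (htri : (pRegularGraph p G).CliqueFree 3) :
    ∃ (A : Set G) (b₀ : G), IsRegularSplitting p H A b₀ := by
  classical
  have hfin : Finite (PRegularClass p G) := Subtype.finite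
  have hnonempty : Nonempty (PRegularClass p G) := by
    by_contra hempty
    exact hdisc fun C => absurd ⟨C⟩ hempty
  obtain ⟨C, hC⟩ := Finite.exists_max fun D : PRegularClass p G => Nat.card D.1.carrier
  obtain ⟨b₀, hb, hbc, rfl⟩ := exists_eq_pRegularVertex C
  -- `A` must avoid the component of a largest class, so that `b₀` serves as the element of maximal
  -- class size outside `A`.
  refine ⟨{x | ∃ (hx : ¬ p ∣ orderOf x) (hxc : x ∉ Subgroup.center G),
    ¬ (pRegularGraph p G).Reachable (pRegularVertex hb hbc) (pRegularVertex hx hxc)}, b₀, ?_⟩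
  refine
    { prime := hp
      isPComplement := hH
      conj_mem := fun x hx => hG.exists_conj_mem hp hH hx
      nonempty := ?_
      regular := fun a ha => ha.1
      noncentral := fun a ha => ha.2.1
      coprime := ?_
      regular_max := hb
      noncentral_max := hbc
      notMem_max := fun h => h.2.2 (SimpleGraph.Reachable.refl _)
      le_max := ?_
      no_triangle := ?_ }
  · by_contra hempty
    have hall : ∀ D, (pRegularGraph p G).Reachable (pRegularVertex hb hbc) D := by
      intro D
      obtain ⟨x, hx, hxc, rfl⟩ := exists_eq_pRegularVertex D
      by_contra hD
      exact hempty ⟨x, hx, hxc, hD⟩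
    exact hdisc fun D E => (hall D).symm.trans (hall E)
  · rintro a ⟨ha, hac, hna⟩ x hx hxc hxA
    by_contra hcop
    have hreach : (pRegularGraph p G).Reachable (pRegularVertex hb hbc)
        (pRegularVertex hx hxc) := by
      by_contra hn
      exact hxA ⟨hx, hxc, hn⟩
    refine hna (hreach.trans ?_)
    by_cases hconj : IsConj x a
    · rw [(pRegularVertex_eq_iff hx hxc ha hac).2 hconj]
    · exact ((pRegularGraph_adj_iff hx hxc ha hac).2
        ⟨hconj, fun h => hcop h.symm⟩).reachable
  · intro x hx hxc
    have := hC (pRegularVertex hx hxc)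
    rwa [card_pRegularVertex, card_pRegularVertex] at this
  · intro x y z hx hy hz hxc hyc hzc q hq hqx hqy hqz
    by_contra! hconj
    refine htri {pRegularVertex hx hxc, pRegularVertex hy hyc, pRegularVertex hz hzc}
      (SimpleGraph.is3Clique_triple_iff.2 ⟨?_, ?_, ?_⟩)
    · exact (pRegularGraph_adj_iff hx hxc hy hyc).2
        ⟨hconj.1, Nat.not_coprime_of_dvd_of_dvd hq.one_lt hqx hqy⟩
    · exact (pRegularGraph_adj_iff hx hxc hz hzc).2
        ⟨hconj.2.2, Nat.not_coprime_of_dvd_of_dvd hq.one_lt hqx hqz⟩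
    · exact (pRegularGraph_adj_iff hy hyc hz hzc).2
        ⟨hconj.2.1, Nat.not_coprime_of_dvd_of_dvd hq.one_lt hqy hqz⟩

end Graph

theorem mainTheorem5 {G : Type*} [Group G] [Finite G] (p : ℕ) (hp : p.Prime)
    (hG : IsPSeparable p G) (H : Subgroup G) (hH : IsPComplement p H)
    (hdisc : ¬ (pRegularGraph p G).Preconnected)
    (htri : (pRegularGraph p G).CliqueFree 3) :
    IsQuasiFrobenius H ∧
      (∀ M : Subgroup H, IsQuasiFrobeniusKernel M → IsMulCommutative M) ∧
      (∀ L : Subgroup H, IsQuasiFrobeniusComplement L → IsMulCommutative L) ∧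
      (Subgroup.center H).map H.subtype = H ⊓ Subgroup.center G := by
  obtain ⟨A, b₀, h⟩ := exists_isRegularSplitting hp hG hH hdisc htri
  exact h.isQuasiFrobenius
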